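/- **Setting.** $U$ is a finite set of $n$ items with weights $w:U\to[0,\infty)$, and $W=\sum_{a\in U}w(a)>0$. An algorithm knows $n$. It can take a *proportional* sample (the answer is $(a,w(a))$ with probability $w(a)/W$) or a *uniform* sample (the answer is $(a,w(a))$ with probability $1/n$), test two items for equality, and use internal randomness. All samples are independent. A $(1\pm\varepsilon)$-approximation of $x$ is a value in $[(1-\varepsilon)x,(1+\varepsilon)x]$. **Order.** Items are ordered by weight. Ties are broken by uniformly random, pairwise distinct ranks from $\{0,\dots,n-1\}$, drawn independently of the samples when an item is first seen and then remembered. For a threshold item $\theta$ (identified with its weight in formulas), an item is *heavy* if it is $\ge\theta$ in this order. If the weights are distinct, this means $w(a)\ge w(\theta)$. **Subroutines.** "With success probability $q$" means: return the median of $2\lceil 4/(1-q)\rceil+1$ independent runs. * $\mathrm{BernoulliEstimator}(X,\varepsilon)$: repeat the experiment $X$ until it has succeeded $r=\lceil 12/\varepsilon^2\rceil$ times, and return $r/N$, where $N$ is the number of trials. * $\mathrm{PropEstimator}(\tilde n,\varepsilon)$: take $m=\lceil\sqrt{24\tilde n}/\varepsilon\rceil+1$ samples. With $c_s$ the number of occurrences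 of $s$, return $\binom m2\big(\sum_s \binom{c_s}{2}/w(s)\big)^{-1}$ (which is $\infty$ if no item repeats). * $\mathrm{HarmonicEstimator}(\varepsilon,\tilde\theta,\phi)$: let $\hat p$ be the output of $\mathrm{BernoulliEstimator}(\text{a uniform sample is}\ \ge\phi,\ \varepsilon/3)$ with success probability $9/10$. Take $k=\lceil 45\,\tilde\theta/(\phi(1-\varepsilon/3)\hat p\,\varepsilon^2)\rceil$ proportional samples $a_1,\dots,a_k$, let $H$ be the average of the $b_i$, where $b_i=1/w(a_i)$ if $a_i\ge\phi$ and $b_i=0$ otherwise, and return $\hat p/H$. **$\mathrm{HybridEstimator}(n,\varepsilon)$** (with a constant $C$). Abort if more than $C\,n^{1/3}/\varepsilon^{4/3}$ samples are needed. Otherwise: 1. Let $\theta$ be the $180$-th largest of $\lceil 120\,n^{1/3}\varepsilon^{2/3}\rceil$ uniform samples (counted with multiplicity). 2. Let $\hat p$ be the output of $\mathrm{BernoulliEstimator}(\text{a proportional sample is heavy},\ \varepsilon/3)$ with success probability $19/20$. 3. If $\hat p\ge 1/2$: run $\mathrm{PropEstimator}(2n^{2/3}/\varepsilon^{2/3},\varepsilon/3)$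 with success probability $19/20$ on proportional samples conditioned on being heavy, obtained by rejecting the samples that are not heavy; divide its output by $\hat p$ and return the result. 4. If $\hat p<1/2$: run $\mathrm{HarmonicEstimator}(\varepsilon,3\theta,\theta)$ with success probability $19/20$, multiply its output by $n$, and return the result. **Theorem.** There is an absolute constant $C_0>0$ such that for every $C\ge C_0$, every such $(U,w)$ with $|U|=n$, and every $\varepsilon$ with $8/\sqrt n\le\varepsilon<1$: $\mathrm{HybridEstimator}(n,\varepsilon)$ with constant $C$ never uses more than $C\,n^{1/3}/\varepsilon^{4/3}$ samples, and with probability at least $2/3$ it does not abort and returns a $(1\pm\varepsilon)$-approximation of $W$. -/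

import Mathlib

open scoped NNReal ENNReal

namespace HybridSampling

/-- Sampling algorithms in the hybrid setting, as decision trees: `I` is the type of answers to a
sampling query, `α` the type of outputs. An algorithm returns a value, aborts, takes one
proportional sample, takes one uniform sample, or draws a natural number from a law of its own
(internal randomness, which costs no sample), and goes on depending on the answer. It knows the
universe and the weights only through the answers. -/
inductive Alg (I : Type*) (α : Type*)
  | ret (x : α)
  | abort
  | prop (k : I → Alg I α)
  | unif (k : I → Alg I α)
  | coin (μ : PMF ℕ) (k : ℕ → Alg I α)

namespace Alg

/-- Run `A`, then continue with its output. -/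
def bind {I α β : Type*} : Alg I α → (α → Alg I β) → Alg I β
  | ret x, f => f x
  | abort, _ => abort
  | prop k, f => prop fun a => (k a).bind f
  | unif k, f => unif fun a => (k a).bind f
  | coin μ k, f => coin μ fun c => (k c).bind f

/-- One proportional sample. -/
def propSample {I : Type*} : Alg I I := prop ret

/-- One uniform sample. -/
def unifSample {I : Type*} : Alg I I := unif ret

/-- `m` independent runs of `A`, and the list of their outputs. -/
def replicate {I α : Type*} (A : Alg I α) : ℕ → Alg I (List α)
  | 0 => ret []
  | m + 1 => A.bind fun x => (replicate A m).bind fun l => ret (x :: l)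

/-- Abort as soon as `A` asks for more than `B` samples. -/
def withBudget {I α : Type*} : Alg I α → ℕ → Alg I α
  | ret x, _ => ret x
  | abort, _ => abort
  | prop _, 0 => abort
  | prop k, B + 1 => prop fun a => (k a).withBudget B
  | unif _, 0 => abort
  | unif k, B + 1 => unif fun a => (k a).withBudget B
  | coin μ k, B => coin μ fun c => (k c).withBudget B

end Alg

/-! ### The law of a run on an instance `(U, w)` -/

section Semantics

variable {U : Type*} [Fintype U]

/-- Proportional sampling: `a` has probability `w a / W`, where `W = ∑ a, w a`. -/
noncomputable def propDist (w : U → ℝ≥0) (hW : ∑ a, w a ≠ 0) : PMF U :=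
  PMF.ofFintype (fun a => ((w a / ∑ b, w b : ℝ≥0) : ℝ≥0∞)) (by
    rw [← ENNReal.ofNNReal_finsetSum, ← Finset.sum_div, div_self hW, ENNReal.coe_one])

/-- The joint law of the output (`none` if the algorithm aborts) and of the number of samples
taken, when `Alg` is run on the instance `(U, w)`. A sample of the item `a` is answered by
`(a, w a)`. -/
noncomputable def run [Nonempty U] (w : U → ℝ≥0) (hW : ∑ a, w a ≠ 0) {α : Type*} :
    Alg (U × ℝ≥0) α → PMF (Option α × ℕ)
  | .ret x => PMF.pure (some x, 0)
  | .abort => PMF.pure (none, 0)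
  | .prop k => (propDist w hW).bind fun a =>
      (run w hW (k (a, w a))).map fun y => (y.1, y.2 + 1)
  | .unif k => (PMF.uniformOfFintype U).bind fun a =>
      (run w hW (k (a, w a))).map fun y => (y.1, y.2 + 1)
  | .coin μ k => μ.bind fun c => run w hW (k c)

end Semantics

/-- `x` is a `(1 ± ε)`-approximation of `W`. -/
def IsApprox (ε : ℝ) (W : ℝ≥0) (x : ℝ≥0∞) : Prop :=
  ENNReal.ofReal ((1 - ε) * W) ≤ x ∧ x ≤ ENNReal.ofReal ((1 + ε) * W)

/-! ### Breaking ties between items of equal weight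

Every item that is seen gets a rank in `{0, …, n - 1}`. The ranks are uniformly random and pairwise
distinct; they are drawn when an item is seen for the first time, and remembered, so that only
equality tests between items are needed. -/

/-- A sampled item, with its weight and its rank. -/
structure Item (U : Type*) where
  item : U
  weight : ℝ≥0
  rank : ℕ

/-- Items are ordered by weight, and items of equal weight by rank. -/
abbrev Key := ℝ≥0 ×ₗ ℕ

/-- The position of an item in the order. -/
def Item.key {U : Type*} (x : Item U) : Key := toLex (x.weight, x.rank)

/-- The weight that belongs to a key. -/
def Key.weight (θ : Key) : ℝ≥0 := (ofLex θ).1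

/-- A uniformly random element of `{0, …, n - 1}` that the table `T` does not use yet. (There is
one whenever `T` holds fewer than `n` items.) -/
noncomputable def freshRank {U : Type*} (n : ℕ) (T : List (U × ℕ)) : PMF ℕ :=
  if h : (Finset.range n \ (T.map Prod.snd).toFinset).Nonempty then PMF.uniformOfFinset _ h
  else PMF.pure 0

/-- Look up the rank of `a` in the table `T`, or draw it and store it, then continue. -/
noncomputable def withRank {U : Type*} [DecidableEq U] {I α : Type*} (n : ℕ) (T : List (U × ℕ))
    (a : U) (k : ℕ → List (U × ℕ) → Alg I α) : Alg I α :=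
  match T.lookup a with
  | some r => k r T
  | none => .coin (freshRank n T) fun r => k r ((a, r) :: T)

/-- Run an algorithm that works with ranks on answers without ranks; `T` is the table of the ranks
assigned so far. -/
noncomputable def attachRanks {U : Type*} [DecidableEq U] {α : Type*} (n : ℕ) :
    Alg (Item U) α → List (U × ℕ) → Alg (U × ℝ≥0) α
  | .ret x, _ => .ret x
  | .abort, _ => .abort
  | .prop k, T => .prop fun a => withRank n T a.1 fun r T' => attachRanks n (k ⟨a.1, a.2, r⟩) T'
  | .unif k, T => .unif fun a => withRank n T a.1 fun r T' => attachRanks n (k ⟨a.1, a.2, r⟩) T'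
  | .coin μ k, T => .coin μ fun c => attachRanks n (k c) T

/-! ### Subroutines

Loops take a bound `fuel` on their number of rounds and abort beyond it. Each round takes a sample,
and `fuel` will be the total number of samples after which the main algorithm aborts anyway. -/

/-- The `k`-th largest entry of a list (counted from `1`, with multiplicity). -/
noncomputable def kthLargest {α : Type*} [LinearOrder α] [OrderBot α] (k : ℕ) (l : List α) : α :=
  (l.insertionSort (· ≥ ·)).getD (k - 1) ⊥

/-- The median of a list of odd length. -/
noncomputable def median {α : Type*} [LinearOrder α] [OrderBot α] (l : List α) : α :=
  kthLargest ((l.length + 1) / 2) l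

/-- Probability amplification: the median of sufficiently many (an odd number of) independent runs
of an estimator that succeeds with probability `2 / 3` succeeds with probability `q`. -/
noncomputable def amplify {I α : Type*} [LinearOrder α] [OrderBot α] (q : ℝ) (A : Alg I α) :
    Alg I α :=
  (A.replicate (2 * ⌈4 / (1 - q)⌉₊ + 1)).bind fun l => .ret (median l)

/-- Repeat the experiment `X` until it has succeeded `r` times, and return the number of trials. -/
def trials {I : Type*} (X : Alg I Bool) : (fuel r : ℕ) → Alg I ℕ
  | _, 0 => .ret 0
  | 0, _ + 1 => .abort
  | fuel + 1, r + 1 => X.bind fun b =>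
      (trials X fuel (if b then r else r + 1)).bind fun N => .ret (N + 1)

/-- Repeat `X` until its output is good, and return that output. -/
def repeatUntil {I α : Type*} (good : α → Prop) [DecidablePred good] (X : Alg I α) :
    (fuel : ℕ) → Alg I α
  | 0 => .abort
  | fuel + 1 => X.bind fun x => if good x then .ret x else repeatUntil good X fuel

/-- `BernoulliEstimator`: estimate the success probability `p` of `X` by inverse sampling. If `N`
trials are made until the `r`-th success, where `r = ⌈12 / ε ^ 2⌉`, then the estimate is `r / N`. -/
noncomputable def bernoulliEstimator {I : Type*} (fuel : ℕ) (X : Alg I Bool) (ε : ℝ) : Alg I ℝ≥0 :=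
  (trials X fuel ⌈12 / ε ^ 2⌉₊).bind fun N => .ret ((⌈12 / ε ^ 2⌉₊ : ℝ≥0) / (N : ℝ≥0))

/-- `PropEstimator`, with samples drawn by `X`: from `m` samples, among which the item `s` occurs
`c_s` times, compute `(m choose 2) / ∑ s, (c_s choose 2) / w s`, which is `∞` if there is no
repetition. -/
noncomputable def propEstimator {U I : Type*} [DecidableEq U] (X : Alg I (Item U)) (n' ε : ℝ) :
    Alg I ℝ≥0∞ :=
  let m : ℕ := ⌈√(24 * n') / ε⌉₊ + 1
  (X.replicate m).bind fun l =>
    let S : List (U × ℝ≥0) := l.map fun x => (x.item, x.weight)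
    .ret ((m.choose 2 : ℝ≥0∞) / ∑ s ∈ S.toFinset, ((S.count s).choose 2 : ℝ≥0∞) / (s.2 : ℝ≥0∞))

/-- `HarmonicEstimator`, which estimates `W / n`: the items at or above `φ` in the order are the
heavy ones, and `θ'` is the advice on `W / n`. -/
noncomputable def harmonicEstimator {U : Type*} (fuel : ℕ) (ε : ℝ) (θ' : ℝ≥0) (φ : Key) :
    Alg (Item U) ℝ≥0∞ :=
  (amplify (9 / 10) (bernoulliEstimator fuel
    (Alg.unifSample.bind fun a => .ret (decide (φ ≤ a.key))) (ε / 3))).bind fun p =>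
  let k : ℕ := ⌈45 * (θ' : ℝ) / ((φ.weight : ℝ) * (1 - ε / 3) * p * ε ^ 2)⌉₊
  (Alg.propSample.replicate k).bind fun l =>
    let b : List ℝ≥0∞ := l.map fun a => if φ ≤ a.key then (a.weight : ℝ≥0∞)⁻¹ else 0
    let H : ℝ≥0∞ := b.sum / (k : ℝ≥0∞)
    .ret ((p : ℝ≥0∞) / H)

/-- The empirical quantile: the `180`-th largest of `120 n^(1/3) ε^(2/3)` uniform samples. -/
noncomputable def findThreshold {U : Type*} (n : ℕ) (ε : ℝ) : Alg (Item U) Key :=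
  (Alg.unifSample.replicate ⌈120 * (n : ℝ) ^ (1 / 3 : ℝ) * ε ^ (2 / 3 : ℝ)⌉₊).bind fun l =>
    .ret (kthLargest 180 (l.map Item.key))

/-- `HybridEstimator` for items with ranks, without the rule on aborting. -/
noncomputable def hybridCore {U : Type*} [DecidableEq U] (fuel n : ℕ) (ε : ℝ) :
    Alg (Item U) ℝ≥0∞ :=
  (findThreshold n ε).bind fun θ =>
  (amplify (19 / 20) (bernoulliEstimator fuel
    (Alg.propSample.bind fun a => .ret (decide (θ ≤ a.key))) (ε / 3))).bind fun p =>
  if (1 / 2 : ℝ≥0) ≤ p then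
    (amplify (19 / 20) (propEstimator
      (repeatUntil (fun a : Item U => θ ≤ a.key) Alg.propSample fuel)
      (2 * ((n : ℝ) ^ (2 / 3 : ℝ) / ε ^ (2 / 3 : ℝ))) (ε / 3))).bind fun Wθ =>
    .ret (Wθ / (p : ℝ≥0∞))
  else
    (amplify (19 / 20) (harmonicEstimator fuel ε (3 * θ.weight) θ)).bind fun ρ =>
    .ret ((n : ℝ≥0∞) * ρ)

/-- `HybridEstimator(n, ε)`, which aborts if it uses more than `C n^(1/3) / ε^(4/3)` samples. -/
noncomputable def hybridEstimator (U : Type*) [DecidableEq U] (C : ℝ) (n : ℕ) (ε : ℝ) :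
    Alg (U × ℝ≥0) ℝ≥0∞ :=
  let B : ℕ := ⌊C * ((n : ℝ) ^ (1 / 3 : ℝ) / ε ^ (4 / 3 : ℝ))⌋₊
  (attachRanks n (hybridCore B n ε) []).withBudget B

end HybridSampling

/-! Put x = n^(1/3) ε^(2/3) and y = x / ε², so that the budget is C·y and n / x = (yε)². The rank of
the threshold among the uniform samples is chosen so that the set H of heavy items has, up to
constants, n / x elements (`failProb_findThreshold_le`). Let p be the share of the total weight W
carried by H. Heavy items weigh at least as much as the average, so p ≥ |H| / n ≥ 1 / (2x), and
inverse sampling estimates p, like |H| / n, to relative error O(ε) with O(1 / (ε² · 1/x)) = O(y)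
samples.

If p is not small, a heavy proportional sample costs O(1) samples by rejection. Collisions among m
such samples, weighted by 1 / w, have mean (m choose 2) / (pW) and relative variance at most |H| /
(m choose 2), so m of order √|H| / ε, which is O(y), suffices to estimate pW; division by the
estimate of p gives W (`failProb_prop_branch_le`). If p is not close to 1, the light items, all of
weight at most θ, carry a constant share of W, whence W ≤ 3nθ. The variable that is 1 / w on heavy
items and 0 elsewhere then has mean |H| / W under proportional sampling and relative variance at
most W / (θ|H|) ≤ 3n / |H| = O(x), so O(x / ε²) = O(y) samples estimate it; dividing the estimate of
|H| / n by it gives W / n (`failProb_harmonic_branch_le`). The two cases overlap, so an approximate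
p can decide between them. The hypothesis 8 / √n ≤ ε says x ≥ 4, which absorbs all roundings.

Three reductions make this a union bound. The law of a run is replaced by a recursively defined
expectation `expect`, for which second and exponential moments follow by induction. Drawing ranks
lazily is the same as drawing a uniform bijection beforehand, so the ranks may be fixed
(`card_mul_expect_attachRanks`). Aborting on budget is the same as counting expensive runs as
failures, so each stage is shown to be both accurate and cheap except with small probability
(`failProb`). Cost needs care: an amplified estimator is cheap only if all its runs are, so a single
run must exceed its cost bound with probability far below the 1/3 that is enough for accuracy. -/

namespace HybridSampling

/-! ### Expectations over the runs of an algorithm -/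

section Expectation

variable {U I α β : Type*} [Fintype U]

/-- The expectation of `g`, a function of the output (`none` if the algorithm aborts) and of the
number of samples. Proportional samples have law `P`, uniform ones `Q`, and a sample of `a` is
answered by `ans a`. -/
noncomputable def expect (P Q : PMF U) (ans : U → I) :
    Alg I α → (Option α → ℕ → ℝ≥0∞) → ℝ≥0∞
  | .ret x, g => g (some x) 0
  | .abort, g => g none 0
  | .prop k, g => ∑ a, P a * expect P Q ans (k (ans a)) fun o c => g o (c + 1)
  | .unif k, g => ∑ a, Q a * expect P Q ans (k (ans a)) fun o c => g o (c + 1)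
  | .coin μ k, g => ∑' c, μ c * expect P Q ans (k c) g

variable (P Q : PMF U) (ans : U → I)

theorem pmf_sum_eq_one (P : PMF U) : ∑ a, P a = 1 := by
  rw [← tsum_fintype (L := .unconditional _), P.tsum_coe]

theorem expect_mono (A : Alg I α) {g g' : Option α → ℕ → ℝ≥0∞} (h : ∀ o c, g o c ≤ g' o c) :
    expect P Q ans A g ≤ expect P Q ans A g' := by
  induction A generalizing g g' with
  | ret x => exact h _ _
  | abort => exact h _ _
  | prop k ih => exact Finset.sum_le_sum fun a _ => by gcongr; exact ih _ fun o c => h o _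
  | unif k ih => exact Finset.sum_le_sum fun a _ => by gcongr; exact ih _ fun o c => h o _
  | coin μ k ih => exact ENNReal.tsum_le_tsum fun c => by gcongr; exact ih _ h

theorem expect_add (A : Alg I α) (g g' : Option α → ℕ → ℝ≥0∞) :
    expect P Q ans A (fun o c => g o c + g' o c) = expect P Q ans A g + expect P Q ans A g' := by
  induction A generalizing g g' with
  | ret x => rfl
  | abort => rfl
  | prop k ih => simp only [expect, ih, mul_add, Finset.sum_add_distrib]
  | unif k ih => simp only [expect, ih, mul_add, Finset.sum_add_distrib]
  | coin μ k ih => simp only [expect, ih, mul_add, ENNReal.tsum_add]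

theorem expect_mul_left (A : Alg I α) (r : ℝ≥0∞) (g : Option α → ℕ → ℝ≥0∞) :
    expect P Q ans A (fun o c => r * g o c) = r * expect P Q ans A g := by
  induction A generalizing g with
  | ret x => rfl
  | abort => rfl
  | prop k ih => simp only [expect, ih, Finset.mul_sum, mul_left_comm]
  | unif k ih => simp only [expect, ih, Finset.mul_sum, mul_left_comm]
  | coin μ k ih => simp only [expect, ih, mul_left_comm _ r, ENNReal.tsum_mul_left]

theorem expect_const (A : Alg I α) (r : ℝ≥0∞) :
    expect P Q ans A (fun _ _ => r) = r := by
  induction A with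
  | ret x => rfl
  | abort => rfl
  | prop k ih => simp only [expect, ih, ← Finset.sum_mul, pmf_sum_eq_one, one_mul]
  | unif k ih => simp only [expect, ih, ← Finset.sum_mul, pmf_sum_eq_one, one_mul]
  | coin μ k ih => simp only [expect, ih, ENNReal.tsum_mul_right, PMF.tsum_coe, one_mul]

/-- How a functional of the output of `A.bind f` reads off from the output of `A`. -/
noncomputable def bindExpect (f : α → Alg I β) (g : Option β → ℕ → ℝ≥0∞) :
    Option α → ℕ → ℝ≥0∞
  | none, c => g none c
  | some x, c => expect P Q ans (f x) fun o d => g o (c + d)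

theorem expect_bind (A : Alg I α) (f : α → Alg I β) (g : Option β → ℕ → ℝ≥0∞) :
    expect P Q ans (A.bind f) g = expect P Q ans A (bindExpect P Q ans f g) := by
  have shift : ∀ g : Option β → ℕ → ℝ≥0∞, bindExpect P Q ans f (fun o c => g o (c + 1)) =
      fun o c => bindExpect P Q ans f g o (c + 1) := by
    intro g
    funext o c
    cases o with
    | none => rfl
    | some x => simp only [bindExpect, add_right_comm]
  induction A generalizing g with
  | ret x => simp [Alg.bind, expect, bindExpect]
  | abort => rfl
  | prop k ih => simp only [Alg.bind, expect, ih, shift]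
  | unif k ih => simp only [Alg.bind, expect, ih, shift]
  | coin μ k ih => simp only [Alg.bind, expect, ih]

/-- A budget changes only the runs that use more than `B` samples. Since aborting is worth 0 here,
cutting such a run off is the same as giving it the value 0. -/
theorem expect_withBudget (A : Alg I α) (B : ℕ) (g : α → ℝ≥0∞) :
    expect P Q ans (A.withBudget B) (fun o _ => o.elim 0 g) =
      expect P Q ans A fun o c => if c ≤ B then o.elim 0 g else 0 := by
  induction A generalizing B with
  | ret x => simp [Alg.withBudget, expect]
  | abort => simp [Alg.withBudget, expect]
  | prop k ih =>
    cases B with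
    | zero => simp [Alg.withBudget, expect, expect_const]
    | succ B => simp [Alg.withBudget, expect, ih]
  | unif k ih =>
    cases B with
    | zero => simp [Alg.withBudget, expect, expect_const]
    | succ B => simp [Alg.withBudget, expect, ih]
  | coin μ k ih => simp only [Alg.withBudget, expect, ih]

end Expectation

/-! ### The law of a run, expressed through `expect` -/

section Run

variable {U α : Type*} [Fintype U] [Nonempty U]

theorem tsum_pure_mul {β : Type*} (b : β) (g : β → ℝ≥0∞) : ∑' y, PMF.pure b y * g y = g b := by
  rw [tsum_eq_single b]
  · simp
  · intro y hy
    simp [PMF.pure_apply, hy]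

theorem tsum_bind_mul {β γ : Type*} (p : PMF β) (f : β → PMF γ) (g : γ → ℝ≥0∞) :
    ∑' y, p.bind f y * g y = ∑' b, p b * ∑' y, f b y * g y := by
  simp only [PMF.bind_apply, ← ENNReal.tsum_mul_right, ← ENNReal.tsum_mul_left]
  rw [ENNReal.tsum_comm]
  simp only [mul_assoc]

theorem tsum_map_mul {β γ : Type*} (p : PMF β) (f : β → γ) (g : γ → ℝ≥0∞) :
    ∑' y, p.map f y * g y = ∑' b, p b * g (f b) := by
  simp only [PMF.map, tsum_bind_mul, Function.comp, tsum_pure_mul]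

theorem tsum_run_mul (w : U → ℝ≥0) (hW : ∑ a, w a ≠ 0) (A : Alg (U × ℝ≥0) α)
    (g : Option α → ℕ → ℝ≥0∞) :
    ∑' y, run w hW A y * g y.1 y.2 =
      expect (propDist w hW) (PMF.uniformOfFintype U) (fun a => (a, w a)) A g := by
  induction A generalizing g with
  | ret x => exact tsum_pure_mul _ fun y : Option α × ℕ => g y.1 y.2
  | abort => exact tsum_pure_mul _ fun y : Option α × ℕ => g y.1 y.2
  | prop k ih =>
    simp only [run, expect]
    rw [tsum_bind_mul _ _ fun y : Option α × ℕ => g y.1 y.2, tsum_fintype]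
    simp only [tsum_map_mul _ _ fun y : Option α × ℕ => g y.1 y.2]
    exact Finset.sum_congr rfl fun a _ => by rw [ih _ fun o c => g o (c + 1)]
  | unif k ih =>
    simp only [run, expect]
    rw [tsum_bind_mul _ _ fun y : Option α × ℕ => g y.1 y.2, tsum_fintype]
    simp only [tsum_map_mul _ _ fun y : Option α × ℕ => g y.1 y.2]
    exact Finset.sum_congr rfl fun a _ => by rw [ih _ fun o c => g o (c + 1)]
  | coin μ k ih =>
    simp only [run, expect]
    rw [tsum_bind_mul _ _ fun y : Option α × ℕ => g y.1 y.2]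
    simp only [ih]

theorem run_withBudget_cost_le (w : U → ℝ≥0) (hW : ∑ a, w a ≠ 0) (A : Alg (U × ℝ≥0) α) (B : ℕ) :
    ∀ y ∈ (run w hW (A.withBudget B)).support, y.2 ≤ B := by
  induction A generalizing B with
  | ret x => simp [Alg.withBudget, run]
  | abort => simp [Alg.withBudget, run]
  | prop k ih =>
    cases B with
    | zero => simp [Alg.withBudget, run]
    | succ B =>
      intro y hy
      simp only [Alg.withBudget, run, PMF.mem_support_bind_iff, PMF.mem_support_map_iff] at hy
      obtain ⟨a, -, z, hz, rfl⟩ := hy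
      exact Nat.succ_le_succ (ih _ _ z hz)
  | unif k ih =>
    cases B with
    | zero => simp [Alg.withBudget, run]
    | succ B =>
      intro y hy
      simp only [Alg.withBudget, run, PMF.mem_support_bind_iff, PMF.mem_support_map_iff] at hy
      obtain ⟨a, -, z, hz, rfl⟩ := hy
      exact Nat.succ_le_succ (ih _ _ z hz)
  | coin μ k ih =>
    intro y hy
    simp only [Alg.withBudget, run, PMF.mem_support_bind_iff] at hy
    obtain ⟨c, -, hz⟩ := hy
    exact ih _ _ y hz

open Classical in
theorem run_withBudget_toOuterMeasure (w : U → ℝ≥0) (hW : ∑ a, w a ≠ 0) (A : Alg (U × ℝ≥0) α)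
    (B : ℕ) (G : α → Prop) :
    (run w hW (A.withBudget B)).toOuterMeasure {y | ∃ x, y.1 = some x ∧ G x} =
      expect (propDist w hW) (PMF.uniformOfFintype U) (fun a => (a, w a)) A
        fun o c => if c ≤ B then o.elim 0 (fun x => if G x then 1 else 0) else 0 := by
  rw [← expect_withBudget, ← tsum_run_mul, PMF.toOuterMeasure_apply]
  refine tsum_congr fun ⟨o, c⟩ => ?_
  cases o with
  | none => simp [Set.indicator]
  | some x => by_cases h : G x <;> simp [Set.indicator, h]

end Run

/-! ### Drawing all ranks in advance -/

section Ranks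

variable {U : Type*} [Fintype U] [DecidableEq U] {α : Type*} {n : ℕ}

/-- The assignments of ranks to all items that agree with the table `T`. -/
def extensions (n : ℕ) (T : List (U × ℕ)) : Finset (U ≃ Fin n) :=
  {σ | ∀ a r, T.lookup a = some r → (σ a : ℕ) = r}

theorem mem_extensions {T : List (U × ℕ)} {σ : U ≃ Fin n} :
    σ ∈ extensions n T ↔ ∀ a r, T.lookup a = some r → (σ a : ℕ) = r := by
  simp [extensions]

theorem mem_extensions_cons {T : List (U × ℕ)} {a : U} {r : ℕ} (ha : T.lookup a = none)
    {σ : U ≃ Fin n} :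
    σ ∈ extensions n ((a, r) :: T) ↔ σ ∈ extensions n T ∧ (σ a : ℕ) = r := by
  simp only [mem_extensions, List.lookup_cons]
  constructor
  · refine fun h => ⟨fun b s hb => h b s ?_, h a r (by simp)⟩
    rcases eq_or_ne b a with rfl | hne
    · simp [ha] at hb
    · simpa [beq_eq_false_iff_ne.2 hne] using hb
  · rintro ⟨h, h'⟩ b s hb
    rcases eq_or_ne b a with rfl | hne
    · simp at hb; omega
    · exact h b s (by simpa [beq_eq_false_iff_ne.2 hne] using hb)

/-- The ranks that the table `T` does not use yet. -/
def freeRanks (n : ℕ) (T : List (U × ℕ)) : Finset ℕ :=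
  Finset.range n \ (T.map Prod.snd).toFinset

/-- Every rank in the table is the rank of an item. -/
def Consistent (T : List (U × ℕ)) : Prop :=
  ∀ r ∈ T.map Prod.snd, ∃ a, T.lookup a = some r

omit [Fintype U] in
theorem Consistent.cons {T : List (U × ℕ)} (hT : Consistent T) {a : U}
    (ha : T.lookup a = none) (r : ℕ) : Consistent ((a, r) :: T) := by
  intro s hs
  simp only [List.map_cons, List.mem_cons] at hs
  rcases hs with rfl | hs
  · exact ⟨a, by simp⟩
  · obtain ⟨b, hb⟩ := hT s hs
    refine ⟨b, ?_⟩
    have hne : b ≠ a := by rintro rfl; simp [ha] at hb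
    simpa [List.lookup_cons, beq_eq_false_iff_ne.2 hne] using hb

/-- Consistency excludes shadowed entries of the table, which would block a rank that no item bears.
Every blocked rank then belongs to another item, and `σ` is injective. -/
theorem rank_mem_freeRanks {T : List (U × ℕ)} (hT : Consistent T) {a : U}
    (ha : T.lookup a = none) {σ : U ≃ Fin n} (hσ : σ ∈ extensions n T) :
    (σ a : ℕ) ∈ freeRanks n T := by
  simp only [freeRanks, Finset.mem_sdiff, Finset.mem_range, (σ a).isLt, true_and,
    List.mem_toFinset]
  intro h
  obtain ⟨b, hb⟩ := hT _ h
  have := mem_extensions.1 hσ b _ hb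
  have : b = a := σ.injective (Fin.ext this)
  subst this
  simp [ha] at hb

omit [Fintype U] in
theorem mem_map_snd_of_lookup {T : List (U × ℕ)} {a : U} {r : ℕ} (h : T.lookup a = some r) :
    r ∈ T.map Prod.snd := by
  induction T with
  | nil => simp at h
  | cons x T ih =>
    obtain ⟨b, s⟩ := x
    rw [List.lookup_cons] at h
    by_cases hb : a == b
    · simp [hb] at h; simp [h]
    · simp [hb] at h; exact List.mem_cons_of_mem _ (ih (by simpa using h))

/-- Exchanging the free ranks `r` and `s` leaves the items in the table alone and maps the
extensions with `a ↦ r` injectively to those with `a ↦ s`. By symmetry, a uniform extension gives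
`a` a uniform free rank. -/
theorem card_extensions_cons_le {T : List (U × ℕ)} {a : U} (ha : T.lookup a = none) {r s : ℕ}
    (hr : r ∈ freeRanks n T) (hs : s ∈ freeRanks n T) :
    (extensions n ((a, r) :: T)).card ≤ (extensions n ((a, s) :: T)).card := by
  simp only [freeRanks, Finset.mem_sdiff, Finset.mem_range, List.mem_toFinset] at hr hs
  refine Finset.card_le_card_of_injOn
    (fun σ => σ.trans (Equiv.swap (⟨r, hr.1⟩ : Fin n) ⟨s, hs.1⟩)) ?_ ?_
  · intro σ hσ
    simp only [Finset.mem_coe, mem_extensions_cons ha] at hσ ⊢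
    obtain ⟨h1, h2⟩ := hσ
    constructor
    · rw [mem_extensions] at h1 ⊢
      intro b t hb
      have ht := mem_map_snd_of_lookup hb
      have hbt := h1 b t hb
      rw [Equiv.trans_apply, Equiv.swap_apply_of_ne_of_ne, hbt]
      · rintro h; rw [h] at hbt; simp only at hbt; exact hr.2 (hbt ▸ ht)
      · rintro h; rw [h] at hbt; simp only at hbt; exact hs.2 (hbt ▸ ht)
    · have : σ a = ⟨r, hr.1⟩ := Fin.ext h2
      simp [this]
  · intro σ _ τ _ h
    ext b
    have := DFunLike.congr_fun h b
    simpa [Fin.ext_iff] using this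

theorem card_extensions_eq {T : List (U × ℕ)} (hT : Consistent T) {a : U}
    (ha : T.lookup a = none) {r : ℕ} (hr : r ∈ freeRanks n T) :
    (extensions n T).card = (freeRanks n T).card * (extensions n ((a, r) :: T)).card := by
  rw [Finset.card_eq_sum_card_fiberwise (f := fun σ => (σ a : ℕ)) (t := freeRanks n T)
    fun σ hσ => rank_mem_freeRanks hT ha hσ]
  rw [Finset.sum_const_nat]
  intro s hs
  rw [(card_extensions_cons_le ha hr hs).antisymm (card_extensions_cons_le ha hs hr)]
  congr 1
  ext σ
  simp [mem_extensions_cons ha]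

/-- The answer to a sample when the ranks are given by `σ`. -/
def rankedItem (w : U → ℝ≥0) (σ : U ≃ Fin n) (a : U) : Item U := ⟨a, w a, σ a⟩

/-- If `a` is in the table, all extensions agree on its rank. Otherwise the extensions are sorted by
the rank of `a`: the classes have equal size and correspond to the values of the fresh draw. -/
theorem card_mul_expect_withRank (P Q : PMF U) (w : U → ℝ≥0) {T : List (U × ℕ)}
    (hT : Consistent T) (hne : (extensions n T).Nonempty) (a : U)
    (k : ℕ → Alg (Item U) α) (g : Option α → ℕ → ℝ≥0∞)
    (ih : ∀ r T, Consistent T → (extensions n T).Nonempty →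
      (extensions n T).card * expect P Q (fun a => (a, w a)) (attachRanks n (k r) T) g =
        ∑ σ ∈ extensions n T, expect P Q (rankedItem w σ) (k r) g) :
    (extensions n T).card * expect P Q (fun a => (a, w a))
        (withRank n T a fun r T' => attachRanks n (k r) T') g =
      ∑ σ ∈ extensions n T, expect P Q (rankedItem w σ) (k (σ a)) g := by
  unfold withRank
  cases ha : T.lookup a with
  | some r =>
    simp only
    rw [ih r T hT hne]
    exact Finset.sum_congr rfl fun σ hσ => by rw [mem_extensions.1 hσ a r ha]
  | none =>
    have hfree : (freeRanks n T).Nonempty := by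
      obtain ⟨σ, hσ⟩ := hne
      exact ⟨_, rank_mem_freeRanks hT ha hσ⟩
    -- The fallback value of `freshRank` is never used, because the table has an extension.
    have hfresh : freshRank n T = PMF.uniformOfFinset _ hfree := dif_pos hfree
    simp only [expect, hfresh]
    rw [tsum_eq_sum (s := freeRanks n T) (fun r hr => by
      rw [PMF.uniformOfFinset_apply_of_notMem hfree hr, zero_mul])]
    rw [Finset.mul_sum, ← Finset.sum_fiberwise_of_maps_to (g := fun σ => (σ a : ℕ))
      fun σ hσ => rank_mem_freeRanks hT ha hσ]
    refine Finset.sum_congr rfl fun r hr => ?_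
    have hcard := card_extensions_eq hT ha hr
    have hpos : (extensions n ((a, r) :: T)).Nonempty := by
      rw [← Finset.card_pos]
      have := Finset.card_pos.2 hne
      by_contra h
      simp only [not_lt, Nat.le_zero] at h
      rw [h, mul_zero] at hcard
      omega
    have key := ih r _ (hT.cons ha r) hpos
    have hf : (extensions n T).filter (fun σ => (σ a : ℕ) = r) = extensions n ((a, r) :: T) := by
      ext σ
      simp [mem_extensions_cons ha]
    rw [hf, Finset.sum_congr (g := fun σ => expect P Q (rankedItem w σ) (k r) g) rfl
      (fun σ hσ => by rw [((mem_extensions_cons ha).1 hσ).2]), ← key,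
      PMF.uniformOfFinset_apply_of_mem hfree hr, hcard]
    have h0 : ((freeRanks n T).card : ℝ≥0∞) ≠ 0 := by
      simpa using hfree.ne_empty
    push_cast
    rw [← mul_assoc, mul_right_comm ((freeRanks n T).card : ℝ≥0∞),
      ENNReal.mul_inv_cancel h0 (by simp), one_mul]

/-- Principle of deferred decisions: conditionally on the table, ranks drawn on demand behave like
those of a uniform bijection extending it. The cardinality stays on the left to avoid division. -/
theorem card_mul_expect_attachRanks (P Q : PMF U) (w : U → ℝ≥0) (A : Alg (Item U) α)
    {T : List (U × ℕ)} (hT : Consistent T) (hne : (extensions n T).Nonempty)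
    (g : Option α → ℕ → ℝ≥0∞) :
    (extensions n T).card * expect P Q (fun a => (a, w a)) (attachRanks n A T) g =
      ∑ σ ∈ extensions n T, expect P Q (rankedItem w σ) A g := by
  induction A generalizing T g with
  | ret x => simp [attachRanks, expect]
  | abort => simp [attachRanks, expect]
  | prop k ih =>
    simp only [attachRanks, expect]
    rw [Finset.mul_sum, Finset.sum_comm]
    refine Finset.sum_congr rfl fun a _ => ?_
    rw [mul_left_comm, card_mul_expect_withRank P Q w hT hne a (fun r => k ⟨a, w a, r⟩) _
      (fun r T hT hne => ih _ hT hne _), Finset.mul_sum]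
    rfl
  | unif k ih =>
    simp only [attachRanks, expect]
    rw [Finset.mul_sum, Finset.sum_comm]
    refine Finset.sum_congr rfl fun a _ => ?_
    rw [mul_left_comm, card_mul_expect_withRank P Q w hT hne a (fun r => k ⟨a, w a, r⟩) _
      (fun r T hT hne => ih _ hT hne _), Finset.mul_sum]
    rfl
  | coin μ k ih =>
    simp only [attachRanks, expect]
    rw [← ENNReal.tsum_mul_left, ← Summable.tsum_finsetSum fun _ _ => ENNReal.summable]
    refine tsum_congr fun c => ?_
    rw [mul_left_comm, ih c hT hne, Finset.mul_sum]

theorem le_expect_attachRanks (P Q : PMF U) (w : U → ℝ≥0) (hn : n = Fintype.card U)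
    (A : Alg (Item U) α) (g : Option α → ℕ → ℝ≥0∞) (b : ℝ≥0∞)
    (h : ∀ σ : U ≃ Fin n, b ≤ expect P Q (rankedItem w σ) A g) :
    b ≤ expect P Q (fun a => (a, w a)) (attachRanks n A []) g := by
  have hne : (extensions n ([] : List (U × ℕ))).Nonempty :=
    ⟨(Fintype.equivFin U).trans (finCongr hn.symm), by simp [mem_extensions]⟩
  have key := card_mul_expect_attachRanks P Q w A (T := []) (by simp [Consistent]) hne g
  have h2 : (extensions n ([] : List (U × ℕ))).card * b ≤
      ∑ σ ∈ extensions n ([] : List (U × ℕ)), expect P Q (rankedItem w σ) A g := by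
    rw [← nsmul_eq_mul]
    exact Finset.card_nsmul_le_sum _ _ _ fun σ _ => h σ
  rw [← key] at h2
  refine (ENNReal.mul_le_mul_iff_right ?_ (by simp)).1 h2
  simpa using hne.ne_empty

end Ranks

/-! ### Order statistics of lists -/

section OrderStatistics

variable {α : Type*} [LinearOrder α] [OrderBot α]

/-- In a decreasing list, the entries with an upward closed property form a prefix. Statements about
order statistics thus become statements about counts. -/
theorem getD_iff_lt_countP (P : α → Prop) [DecidablePred P] (hP : ∀ x y, x ≤ y → P x → P y)
    (l : List α)
    (hl : l.Pairwise (· ≥ ·)) (i : ℕ) (hi : i < l.length) :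
    P (l.getD i ⊥) ↔ i < l.countP (fun x => decide (P x)) := by
  induction l generalizing i with
  | nil => simp at hi
  | cons a t ih =>
    obtain ⟨h1, h2⟩ := List.pairwise_cons.1 hl
    by_cases ha : P a
    · cases i with
      | zero => simp [ha]
      | succ i =>
        simp only [List.getD_cons_succ, List.countP_cons, ha, decide_true, if_true]
        rw [ih h2 i (by simpa using hi)]
        omega
    · have h0 : t.countP (fun x => decide (P x)) = 0 :=
        List.countP_eq_zero.2 fun x hx => by simpa using fun h => ha (hP x a (h1 x hx) h)
      simp only [List.countP_cons, h0, ha]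
      cases i with
      | zero => simp [ha]
      | succ i =>
        rw [List.getD_cons_succ, ih h2 i (by simpa using hi), h0]
        simp

theorem kthLargest_iff (P : α → Prop) [DecidablePred P] (hP : ∀ x y, x ≤ y → P x → P y)
    (l : List α) (k : ℕ)
    (hk : 0 < k) (hkl : k ≤ l.length) :
    P (kthLargest k l) ↔ k ≤ l.countP (fun x => decide (P x)) := by
  unfold kthLargest
  rw [getD_iff_lt_countP P hP _ (List.pairwise_insertionSort _ l) _
    (by rw [List.length_insertionSort]; omega), (List.perm_insertionSort _ l).countP_eq]
  omega

-- If the median lies outside the interval, then the `s + 1` entries on that side of it lie outside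
-- as well.
open Classical in
theorem median_mem_Icc (l : List α) (s : ℕ) (hl : l.length = 2 * s + 1) (lo hi : α)
    (h : l.countP (fun x => decide (x ∉ Set.Icc lo hi)) ≤ s) : median l ∈ Set.Icc lo hi := by
  have hk : (l.length + 1) / 2 = s + 1 := by omega
  unfold median
  rw [hk]
  constructor
  · rw [kthLargest_iff (fun x => lo ≤ x) (fun x y hxy hx => hx.trans hxy) l _ (by omega) (by omega)]
    have h1 := List.length_eq_countP_add_countP (fun x => decide (lo ≤ x)) (l := l)
    have h2 : l.countP (fun x => decide ¬(decide (lo ≤ x)) = true) ≤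
        l.countP (fun x => decide (x ∉ Set.Icc lo hi)) :=
      List.countP_mono_left fun x _ hx => by
        simp only [decide_eq_true_eq, not_le, Set.mem_Icc, not_and_or] at hx ⊢; exact Or.inl hx
    omega
  · by_contra hlt
    rw [not_le, kthLargest_iff (fun x => hi < x) (fun x y hxy hx => hx.trans_le hxy) l _
      (by omega) (by omega)] at hlt
    have h2 : l.countP (fun x => decide (hi < x)) ≤
        l.countP (fun x => decide (x ∉ Set.Icc lo hi)) :=
      List.countP_mono_left fun x _ hx => by
        simp only [decide_eq_true_eq, not_le, Set.mem_Icc, not_and_or] at hx ⊢; exact Or.inr hx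
    omega

end OrderStatistics

/-! ### Failure probabilities -/

section Failure

variable {U I α β : Type*} [Fintype U] (P Q : PMF U) (ans : U → I)

open Classical in
/-- The indicator of the event that there is no output, or that `S` fails for the output and the
number of samples. -/
noncomputable def failInd (S : α → ℕ → Prop) : Option α → ℕ → ℝ≥0∞
  | none, _ => 1
  | some x, c => if S x c then 0 else 1

theorem failInd_le_one (S : α → ℕ → Prop) (o : Option α) (c : ℕ) : failInd S o c ≤ 1 := by
  cases o with
  | none => exact le_rfl
  | some x => simp only [failInd]; split_ifs <;> simp

theorem failInd_some_of {S : α → ℕ → Prop} {x : α} {c : ℕ} (h : S x c) :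
    failInd S (some x) c = 0 := if_pos h

theorem failInd_some_of_not {S : α → ℕ → Prop} {x : α} {c : ℕ} (h : ¬S x c) :
    failInd S (some x) c = 1 := if_neg h

/-- The probability that `A` aborts or that `S` fails for its output and its number of samples. -/
noncomputable def failProb (A : Alg I α) (S : α → ℕ → Prop) : ℝ≥0∞ :=
  expect P Q ans A (failInd S)

theorem failProb_mono (A : Alg I α) {S S' : α → ℕ → Prop} (h : ∀ x c, S x c → S' x c) :
    failProb P Q ans A S' ≤ failProb P Q ans A S := by
  refine expect_mono P Q ans A fun o c => ?_
  cases o with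
  | none => exact le_rfl
  | some x =>
    by_cases hS : S x c
    · rw [failInd_some_of (h x c hS)]; exact zero_le
    · rw [failInd_some_of_not hS]; exact failInd_le_one _ _ _

theorem failProb_le_one (A : Alg I α) (S : α → ℕ → Prop) : failProb P Q ans A S ≤ 1 :=
  (expect_mono P Q ans A (failInd_le_one S)).trans_eq (expect_const P Q ans A 1)

theorem failProb_ret_of {x : α} {S : α → ℕ → Prop} (h : S x 0) :
    failProb P Q ans (.ret x) S = 0 := if_pos h

theorem failProb_bind_eq (A : Alg I α) (f : α → Alg I β) (S : β → ℕ → Prop) :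
    failProb P Q ans (A.bind f) S = expect P Q ans A fun o c =>
      o.elim 1 fun x => failProb P Q ans (f x) fun y d => S y (c + d) := by
  unfold failProb
  rw [expect_bind]
  congr 1
  funext o c
  cases o with
  | none => rfl
  | some x =>
    simp only [bindExpect, Option.elim]
    congr 1
    funext o d
    cases o <;> rfl

/-- The union bound for two consecutive stages. -/
theorem failProb_bind_le (A : Alg I α) (f : α → Alg I β) (S : α → ℕ → Prop) (S' : β → ℕ → Prop)
    {δ δ' : ℝ≥0∞} (h : failProb P Q ans A S ≤ δ)
    (h' : ∀ x c, S x c → failProb P Q ans (f x) (fun y d => S' y (c + d)) ≤ δ') :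
    failProb P Q ans (A.bind f) S' ≤ δ + δ' := by
  rw [failProb_bind_eq]
  calc _ ≤ expect P Q ans A (fun o c => failInd S o c + δ') := by
        refine expect_mono P Q ans A fun o c => ?_
        cases o with
        | none => exact le_self_add
        | some x =>
          by_cases hS : S x c
          · rw [failInd_some_of hS, zero_add]; exact h' x c hS
          · rw [failInd_some_of_not hS]; exact (failProb_le_one _ _ _ _ _).trans le_self_add
    _ = failProb P Q ans A S + δ' := by rw [expect_add, expect_const]; rfl
    _ ≤ δ + δ' := by gcongr

theorem failProb_bind_ret (A : Alg I α) (f : α → β) (S : β → ℕ → Prop) :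
    failProb P Q ans (A.bind fun x => .ret (f x)) S = failProb P Q ans A fun x c => S (f x) c := by
  rw [failProb_bind_eq]
  unfold failProb
  congr 1
  funext o c
  cases o <;> rfl

open Classical in
theorem expect_success_add_failProb (A : Alg I α) (B : ℕ) (G : α → Prop) :
    expect P Q ans A (fun o c => if c ≤ B then o.elim 0 (fun x => if G x then 1 else 0) else 0) +
      failProb P Q ans A (fun x c => G x ∧ c ≤ B) = 1 := by
  unfold failProb
  rw [← expect_add]
  refine Eq.trans ?_ (expect_const P Q ans A 1)
  congr 1
  funext o c
  cases o with
  | none => simp [failInd]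
  | some x => by_cases h : G x <;> by_cases h' : c ≤ B <;>
      simp only [failInd, h, h', if_true, if_false, and_true, and_false, Option.elim] <;> simp

end Failure

/-! ### Independent repetitions -/

section Replicate

variable {U I α : Type*} [Fintype U] (P Q : PMF U) (ans : U → I)

theorem failProb_replicate_all (A : Alg I α) (G : α → Prop) (B : ℕ) {δ : ℝ≥0∞}
    (h : failProb P Q ans A (fun x c => G x ∧ c ≤ B) ≤ δ) (m : ℕ) :
    failProb P Q ans (A.replicate m) (fun l c => l.length = m ∧ (∀ x ∈ l, G x) ∧ c ≤ m * B) ≤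
      m * δ := by
  induction m with
  | zero => simp [Alg.replicate, failProb, expect, failInd]
  | succ m ih =>
    rw [show ((m + 1 : ℕ) : ℝ≥0∞) * δ = δ + m * δ by push_cast; ring]
    refine failProb_bind_le P Q ans A _ _ _ h fun x c hx => ?_
    rw [failProb_bind_ret]
    refine (failProb_mono P Q ans _ ?_).trans ih
    rintro l d ⟨hl, hG, hd⟩
    refine ⟨by simp [hl], by simpa using ⟨hx.1, hG⟩, ?_⟩
    have := hx.2
    rw [Nat.succ_mul]
    omega

/-- Independence in multiplicative form. With `f` equal to a constant on a set and 1 elsewhere, it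
gives the exponential moments behind the Chernoff bounds for the median and for the threshold. -/
theorem expect_replicate_prod (A : Alg I α) (f : α → ℝ≥0∞) (m : ℕ) :
    expect P Q ans (A.replicate m) (fun o _ => o.elim 0 fun l => (l.map f).prod) =
      (expect P Q ans A fun o _ => o.elim 0 f) ^ m := by
  induction m with
  | zero => simp [Alg.replicate, expect]
  | succ m ih =>
    rw [pow_succ, mul_comm, ← ih]
    simp only [Alg.replicate]
    rw [expect_bind, mul_comm, ← expect_mul_left]
    congr 1
    funext o c
    cases o with
    | none => simp [bindExpect]
    | some x =>
      simp only [bindExpect, Option.elim]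
      rw [expect_bind, mul_comm, ← expect_mul_left]
      congr 1
      funext o d
      cases o with
      | none => simp [bindExpect]
      | some l => simp [bindExpect, expect]

theorem prod_ite_eq_pow_countP (l : List α) (G : α → Prop) [DecidablePred G] (r : ℝ≥0∞) :
    (l.map fun x => if G x then r else 1).prod = r ^ l.countP fun x => decide (G x) := by
  induction l with
  | nil => simp
  | cons a l ih => by_cases h : G a <;> simp [h, ih, pow_succ, mul_comm]

variable [LinearOrder α] [OrderBot α]

/-- If all runs are at least `lo`, so is the median. This is a plain union bound, without the
additive tail of the median bound, so a tiny `δ` stays tiny. -/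
theorem failProb_amplify_all (A : Alg I α) (lo : α) (B : ℕ) {δ : ℝ≥0∞}
    (h : failProb P Q ans A (fun x c => lo ≤ x ∧ c ≤ B) ≤ δ) (q : ℝ) :
    failProb P Q ans (amplify q A) (fun x c => lo ≤ x ∧ c ≤ (2 * ⌈4 / (1 - q)⌉₊ + 1) * B) ≤
      (2 * ⌈4 / (1 - q)⌉₊ + 1 : ℕ) * δ := by
  unfold amplify
  rw [failProb_bind_ret]
  refine (failProb_mono P Q ans _ ?_).trans
    (failProb_replicate_all P Q ans A (lo ≤ ·) B h _)
  rintro l c ⟨hl, hG, hc⟩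
  refine ⟨?_, hc⟩
  unfold median
  rw [kthLargest_iff (fun x => lo ≤ x) (fun x y hxy hx => hx.trans hxy) l _ (by omega) (by omega),
    List.countP_eq_length.2 (by simpa using hG)]
  omega

/-- The median of many runs: a good value with probability exponentially close to `1`. -/
theorem failProb_amplify_le (A : Alg I α) (lo hi : α) (B : ℕ) {δ : ℝ≥0∞}
    (hgood : failProb P Q ans A (fun x _ => x ∈ Set.Icc lo hi) ≤ 1 / 3)
    (hcost : failProb P Q ans A (fun _ c => c ≤ B) ≤ δ) (q : ℝ) :
    failProb P Q ans (amplify q A)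
      (fun x c => x ∈ Set.Icc lo hi ∧ c ≤ (2 * ⌈4 / (1 - q)⌉₊ + 1) * B) ≤
      (2 * ⌈4 / (1 - q)⌉₊ + 1 : ℕ) * δ +
        2⁻¹ ^ (⌈4 / (1 - q)⌉₊ + 1) * (4 / 3) ^ (2 * ⌈4 / (1 - q)⌉₊ + 1) := by
  classical
  set s := ⌈4 / (1 - q)⌉₊
  unfold amplify
  rw [failProb_bind_ret]
  -- The product of `f` over the runs is 2 to the number of bad runs, and each factor has
  -- expectation at most 1 + 1/3. A bad median requires `s + 1` bad runs, so Markov's inequality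
  -- applies.
  let f : α → ℝ≥0∞ := fun x => if x ∉ Set.Icc lo hi then 2 else 1
  have hf : expect P Q ans A (fun o _ => o.elim 0 f) ≤ 4 / 3 := by
    calc expect P Q ans A (fun o _ => o.elim 0 f)
        ≤ expect P Q ans A (fun o c => 1 + failInd (fun x _ => x ∈ Set.Icc lo hi) o c) := by
          refine expect_mono P Q ans A fun o c => ?_
          cases o with
          | none => simp
          | some x =>
            by_cases h : x ∈ Set.Icc lo hi
            · simp only [Option.elim, f, failInd, h, not_true_eq_false, if_true, if_false]
              norm_num
            · simp only [Option.elim, f, failInd, h, not_false_eq_true, if_true, if_false]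
              norm_num
      _ ≤ 1 + 1 / 3 := by rw [expect_add, expect_const]; gcongr; exact hgood
      _ = 4 / 3 := by
          rw [← ENNReal.toReal_eq_toReal_iff' (by simp) (by finiteness),
            ENNReal.toReal_add (by simp) (by simp)]
          norm_num
  have hall := failProb_replicate_all P Q ans A (fun _ => True) B (by simpa using hcost)
    (2 * s + 1)
  calc _ ≤ expect P Q ans (A.replicate (2 * s + 1)) (fun o c =>
        failInd (fun l c => l.length = 2 * s + 1 ∧ (∀ x ∈ l, True) ∧ c ≤ (2 * s + 1) * B) o c +
          2⁻¹ ^ (s + 1) * o.elim 0 fun l => (l.map f).prod) := by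
        refine expect_mono P Q ans _ fun o c => ?_
        cases o with
        | none => exact le_self_add
        | some l =>
          change failInd (fun l c => median l ∈ Set.Icc lo hi ∧ c ≤ (2 * s + 1) * B) (some l) c ≤ _
          by_cases h1 : l.length = 2 * s + 1 ∧ (∀ x ∈ l, True) ∧ c ≤ (2 * s + 1) * B
          · by_cases h2 : median l ∈ Set.Icc lo hi ∧ c ≤ (2 * s + 1) * B
            · rw [failInd_some_of
                (S := fun (l : List α) c => median l ∈ Set.Icc lo hi ∧ c ≤ (2 * s + 1) * B) h2]
              exact zero_le
            · have h3 : ¬l.countP (fun x => decide (x ∉ Set.Icc lo hi)) ≤ s := fun h =>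
                h2 ⟨median_mem_Icc l s h1.1 lo hi h, h1.2.2⟩
              rw [failInd_some_of
                (S := fun (l : List α) c =>
                  l.length = 2 * s + 1 ∧ (∀ x ∈ l, True) ∧ c ≤ (2 * s + 1) * B) h1,
                failInd_some_of_not
                (S := fun (l : List α) c => median l ∈ Set.Icc lo hi ∧ c ≤ (2 * s + 1) * B) h2, zero_add]
              simp only [Option.elim, f]
              rw [prod_ite_eq_pow_countP l (fun x => x ∉ Set.Icc lo hi)]
              calc (1 : ℝ≥0∞) = 2⁻¹ ^ (s + 1) * 2 ^ (s + 1) := by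
                    rw [← mul_pow, ENNReal.inv_mul_cancel (by simp) (by simp), one_pow]
                _ ≤ _ := by
                    gcongr
                    · norm_num
                    · omega
          · rw [failInd_some_of_not
              (S := fun (l : List α) c =>
                l.length = 2 * s + 1 ∧ (∀ x ∈ l, True) ∧ c ≤ (2 * s + 1) * B) h1]
            exact (failInd_le_one _ _ _).trans le_self_add
    _ ≤ _ := by
        rw [expect_add, expect_mul_left, expect_replicate_prod]
        gcongr
        exact hall

end Replicate

/-! ### Inverse sampling -/

section Bernoulli

variable {U I : Type*} [Fintype U] (P Q : PMF U) (ans : U → I)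

/-- `X` takes one sample and succeeds with probability `p`. -/
def IsExperiment (X : Alg I Bool) (p : ℝ) : Prop :=
  ∀ g : Option Bool → ℕ → ℝ≥0∞, expect P Q ans X g =
    ENNReal.ofReal p * g (some true) 1 + ENNReal.ofReal (1 - p) * g (some false) 1

/-- Chebyshev for the number of trials, with mean r / p and variance r(1 - p) / p². The bound is the
second moment about `μ`; it satisfies the recursion given by the first trial with equality. The
centre `μ` is arbitrary because each trial shifts it by one. -/
theorem failProb_trials_le {X : Alg I Bool} {p : ℝ} (hX : IsExperiment P Q ans X p) (hp : 0 < p)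
    (hp1 : p ≤ 1) {d : ℝ} (hd : 0 < d) (fuel r : ℕ) (μ : ℝ) (hfuel : μ + d ≤ fuel) :
    failProb P Q ans (trials X fuel r) (fun N c => c = N ∧ r ≤ N ∧ |(N : ℝ) - μ| ≤ d) ≤
      ENNReal.ofReal (((r / p - μ) ^ 2 + r * (1 - p) / p ^ 2) / d ^ 2) := by
  induction fuel generalizing r μ with
  | zero =>
    cases r with
    | zero =>
      by_cases h : |((0 : ℕ) : ℝ) - μ| ≤ d
      · simp only [trials]
        rw [failProb_ret_of P Q ans ⟨rfl, le_rfl, h⟩]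
        exact zero_le
      · refine (failProb_le_one _ _ _ _ _).trans ?_
        rw [ENNReal.one_le_ofReal, one_le_div (by positivity)]
        simp only [Nat.cast_zero, zero_sub, abs_neg, not_le] at h
        simp only [Nat.cast_zero, zero_div, zero_sub, zero_mul, add_zero, neg_sq]
        rw [← sq_abs μ]
        gcongr
    | succ r =>
      refine (failProb_le_one _ _ _ _ _).trans ?_
      rw [ENNReal.one_le_ofReal, one_le_div (by positivity)]
      have h1 : (0 : ℝ) ≤ (r + 1 : ℕ) / p := by positivity
      have h2 : (0 : ℝ) ≤ (r + 1 : ℕ) * (1 - p) / p ^ 2 :=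
        div_nonneg (mul_nonneg (by positivity) (by linarith)) (by positivity)
      -- Out of fuel with successes still missing: `hfuel` puts `μ` at or below `-d`, so the bound
      -- is at least 1 and nothing is claimed.
      have h3 : d ≤ (r + 1 : ℕ) / p - μ := by
        rw [Nat.cast_zero] at hfuel
        linarith
      have h4 : d ^ 2 ≤ ((r + 1 : ℕ) / p - μ) ^ 2 := by gcongr
      linarith
  | succ fuel ih =>
    cases r with
    | zero =>
      by_cases h : |((0 : ℕ) : ℝ) - μ| ≤ d
      · simp only [trials]
        rw [failProb_ret_of P Q ans ⟨rfl, le_rfl, h⟩]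
        exact zero_le
      · refine (failProb_le_one _ _ _ _ _).trans ?_
        rw [ENNReal.one_le_ofReal, one_le_div (by positivity)]
        simp only [Nat.cast_zero, zero_sub, abs_neg, not_le] at h
        simp only [Nat.cast_zero, zero_div, zero_sub, zero_mul, add_zero, neg_sq]
        rw [← sq_abs μ]
        gcongr
    | succ r =>
      simp only [trials]
      rw [failProb_bind_eq, hX]
      simp only [Option.elim, if_true, Bool.false_eq_true, if_false, failProb_bind_ret]
      have hf : (μ - 1) + d ≤ fuel := by push_cast at hfuel; linarith
      have h1 := (failProb_mono P Q ans (trials X fuel r)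
        (S := fun N c => c = N ∧ r ≤ N ∧ |(N : ℝ) - (μ - 1)| ≤ d)
        (S' := fun N c => 1 + c = N + 1 ∧ r + 1 ≤ N + 1 ∧ |((N + 1 : ℕ) : ℝ) - μ| ≤ d)
        fun N c h => ⟨by omega, by omega, by
          rw [show ((N + 1 : ℕ) : ℝ) - μ = N - (μ - 1) by push_cast; ring]; exact h.2.2⟩).trans
        (ih r (μ - 1) hf)
      have h2 := (failProb_mono P Q ans (trials X fuel (r + 1))
        (S := fun N c => c = N ∧ r + 1 ≤ N ∧ |(N : ℝ) - (μ - 1)| ≤ d)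
        (S' := fun N c => 1 + c = N + 1 ∧ r + 1 ≤ N + 1 ∧ |((N + 1 : ℕ) : ℝ) - μ| ≤ d)
        fun N c h => ⟨by omega, by omega, by
          rw [show ((N + 1 : ℕ) : ℝ) - μ = N - (μ - 1) by push_cast; ring]; exact h.2.2⟩).trans
        (ih (r + 1) (μ - 1) hf)
      refine (add_le_add (mul_le_mul_right h1 _) (mul_le_mul_right h2 _)).trans_eq ?_
      have hq : 0 ≤ 1 - p := by linarith
      rw [← ENNReal.ofReal_mul hp.le, ← ENNReal.ofReal_mul hq, ← ENNReal.ofReal_add]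
      · congr 1
        push_cast
        field_simp
        ring
      · exact mul_nonneg hp.le (by positivity)
      · exact mul_nonneg hq (by positivity)

variable {ε p : ℝ} {fuel B : ℕ} {X : Alg I Bool}

theorem bernoulli_count_bounds (hε : 0 < ε) (hε1 : ε < 1) :
    108 / ε ^ 2 ≤ (⌈12 / (ε / 3) ^ 2⌉₊ : ℝ) ∧ (⌈12 / (ε / 3) ^ 2⌉₊ : ℝ) ≤ 109 / ε ^ 2 := by
  have h : 12 / (ε / 3) ^ 2 = 108 / ε ^ 2 := by field_simp; norm_num
  rw [h]
  refine ⟨Nat.le_ceil _, (Nat.ceil_lt_add_one (by positivity)).le.trans ?_⟩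
  have : 1 ≤ 1 / ε ^ 2 := by
    rw [one_le_div (by positivity)]
    exact pow_le_one₀ hε.le hε1.le
  calc 108 / ε ^ 2 + 1 ≤ 108 / ε ^ 2 + 1 / ε ^ 2 := by linarith
    _ = 109 / ε ^ 2 := by ring

/-- Chebyshev with a deviation of ε/6 times the mean number of trials: since r ≥ 108 / ε², the
failure probability is at most 36 / (rε²) ≤ 1/3. The fuel covers twice the mean, as r ≤ 109 / ε². -/
theorem failProb_bernoulliEstimator_le (hX : IsExperiment P Q ans X p) (hp : 0 < p) (hp1 : p ≤ 1)
    (hε : 0 < ε) (hε1 : ε < 1) (hB : 218 / (ε ^ 2 * p) ≤ fuel) :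
    failProb P Q ans (bernoulliEstimator fuel X (ε / 3)) (fun x _ => x ∈ Set.Icc
      (p / (1 + ε / 6)).toNNReal (p / (1 - ε / 6)).toNNReal) ≤ 1 / 3 := by
  obtain ⟨hr1, hr2⟩ := bernoulli_count_bounds hε hε1
  unfold bernoulliEstimator
  rw [failProb_bind_ret]
  set r := ⌈12 / (ε / 3) ^ 2⌉₊
  have hr : (0 : ℝ) < r := lt_of_lt_of_le (by positivity) hr1
  have hd : 0 < r / p * (ε / 6) := by positivity
  have hfuel : r / p + r / p * (ε / 6) ≤ fuel := by
    have h1 : r / p ≤ 109 / (ε ^ 2 * p) := by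
      rw [← div_div]; gcongr
    have h2 : (218 : ℝ) / (ε ^ 2 * p) = 2 * (109 / (ε ^ 2 * p)) := by ring
    have h3 : r / p * (ε / 6) ≤ r / p * 1 := by gcongr; linarith
    linarith
  refine (failProb_mono P Q ans _ ?_).trans
    ((failProb_trials_le P Q ans hX hp hp1 hd fuel r (r / p) hfuel).trans ?_)
  · rintro N c ⟨-, hrN, hN⟩
    rw [abs_le] at hN
    have hN0 : (0 : ℝ) < N := hr.trans_le (by exact_mod_cast hrN)
    have h1 : (r : ℝ) / p * (1 - ε / 6) ≤ N := by linarith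
    have h2 : (N : ℝ) ≤ r / p * (1 + ε / 6) := by linarith
    have hm : 0 < 1 - ε / 6 := by linarith
    constructor
    · rw [Real.toNNReal_le_iff_le_coe, NNReal.coe_div, NNReal.coe_natCast, NNReal.coe_natCast,
        div_le_div_iff₀ (by positivity) hN0]
      calc p * (N : ℝ) ≤ p * (r / p * (1 + ε / 6)) := by gcongr
        _ = r * (1 + ε / 6) := by field_simp
    · rw [← NNReal.coe_le_coe, Real.coe_toNNReal _ (by positivity), NNReal.coe_div,
        NNReal.coe_natCast, NNReal.coe_natCast, div_le_div_iff₀ hN0 hm]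
      calc r * (1 - ε / 6) = p * (r / p * (1 - ε / 6)) := by field_simp
        _ ≤ p * N := by gcongr
  · rw [show (1 / 3 : ℝ≥0∞) = ENNReal.ofReal (1 / 3) by
      rw [ENNReal.ofReal_div_of_pos (by norm_num)]; simp]
    apply ENNReal.ofReal_le_ofReal
    have h1 : ((r / p - r / p) ^ 2 + r * (1 - p) / p ^ 2) / (r / p * (ε / 6)) ^ 2 =
        36 * (1 - p) / (r * ε ^ 2) := by
      field_simp
      ring
    rw [h1, div_le_div_iff₀ (by positivity) (by norm_num)]
    rw [div_le_iff₀ (by positivity)] at hr1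
    nlinarith

/-- At most `K` times the mean number of trials is equivalent to an estimate of at least p / K, so
one Chebyshev bound controls both the cost and gross underestimates. A large `K` makes the failure
probability small enough for a union bound over all runs of an amplification. -/
theorem failProb_bernoulliEstimator_cost_le (hX : IsExperiment P Q ans X p) (hp : 0 < p)
    (hp1 : p ≤ 1) (hε : 0 < ε) (hε1 : ε < 1) {K : ℝ} (hK : 1 < K)
    (hB : 109 * K / (ε ^ 2 * p) ≤ B) (hBf : B ≤ fuel) :
    failProb P Q ans (bernoulliEstimator fuel X (ε / 3))
      (fun x c => (p / K).toNNReal ≤ x ∧ c ≤ B) ≤ ENNReal.ofReal (1 / (108 * (K - 1) ^ 2)) := by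
  obtain ⟨hr1, hr2⟩ := bernoulli_count_bounds hε hε1
  unfold bernoulliEstimator
  rw [failProb_bind_ret]
  set r := ⌈12 / (ε / 3) ^ 2⌉₊
  have hr : (0 : ℝ) < r := lt_of_lt_of_le (by positivity) hr1
  have hK' : 0 < K - 1 := by linarith
  have hd : 0 < r / p * (K - 1) := by positivity
  have hB' : r / p * K ≤ B := by
    refine le_trans ?_ hB
    rw [show 109 * K / (ε ^ 2 * p) = 109 / ε ^ 2 / p * K by field_simp]
    gcongr
  have hfuel : r / p + r / p * (K - 1) ≤ fuel := by
    have : (B : ℝ) ≤ fuel := by exact_mod_cast hBf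
    linarith
  refine (failProb_mono P Q ans _ ?_).trans
    ((failProb_trials_le P Q ans hX hp hp1 hd fuel r (r / p) hfuel).trans ?_)
  · rintro N c ⟨rfl, hrN, hN⟩
    rw [abs_le] at hN
    have hN0 : (0 : ℝ) < c := hr.trans_le (by exact_mod_cast hrN)
    have h2 : (c : ℝ) ≤ r / p * K := by linarith
    constructor
    · rw [Real.toNNReal_le_iff_le_coe, NNReal.coe_div, NNReal.coe_natCast, NNReal.coe_natCast,
        div_le_div_iff₀ (by positivity) hN0]
      calc p * (c : ℝ) ≤ p * (r / p * K) := by gcongr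
        _ = r * K := by field_simp
    · exact_mod_cast h2.trans hB'
  · apply ENNReal.ofReal_le_ofReal
    have h1 : ((r / p - r / p) ^ 2 + r * (1 - p) / p ^ 2) / (r / p * (K - 1)) ^ 2 =
        (1 - p) / (r * (K - 1) ^ 2) := by
      field_simp
      ring
    have h2 : (108 : ℝ) ≤ r := by
      refine le_trans ?_ hr1
      rw [le_div_iff₀ (by positivity)]
      have : ε ^ 2 ≤ 1 := pow_le_one₀ hε.le hε1.le
      linarith
    rw [h1]
    gcongr
    linarith

end Bernoulli

/-! ### Lists of independent samples -/

section Iid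

variable {U : Type*} [Fintype U]

/-- The expectation of `g` over lists of `m` independent samples with law `p`. -/
noncomputable def iid (p : U → ℝ) : ℕ → (List U → ℝ) → ℝ
  | 0, g => g []
  | m + 1, g => ∑ a, p a * iid p m fun l => g (a :: l)

variable {p : U → ℝ}

theorem iid_add (m : ℕ) (g g' : List U → ℝ) :
    iid p m (fun l => g l + g' l) = iid p m g + iid p m g' := by
  induction m generalizing g g' with
  | zero => rfl
  | succ m ih => simp only [iid, ih, mul_add, Finset.sum_add_distrib]

theorem iid_mul_left (m : ℕ) (r : ℝ) (g : List U → ℝ) :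
    iid p m (fun l => r * g l) = r * iid p m g := by
  induction m generalizing g with
  | zero => rfl
  | succ m ih => simp only [iid, ih, Finset.mul_sum, mul_left_comm]

theorem iid_const (hp : ∑ a, p a = 1) (m : ℕ) (r : ℝ) : iid p m (fun _ => r) = r := by
  induction m with
  | zero => rfl
  | succ m ih => simp only [iid, ih, ← Finset.sum_mul, hp, one_mul]

theorem iid_sum {ι : Type*} (s : Finset ι) (m : ℕ) (g : ι → List U → ℝ) :
    iid p m (fun l => ∑ i ∈ s, g i l) = ∑ i ∈ s, iid p m (g i) := by
  induction m generalizing g with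
  | zero => rfl
  | succ m ih =>
    simp only [iid, ih, Finset.mul_sum]
    rw [Finset.sum_comm]

theorem iid_congr (m : ℕ) {g g' : List U → ℝ}
    (h : ∀ l, l.length = m → (∀ a ∈ l, p a ≠ 0) → g l = g' l) : iid p m g = iid p m g' := by
  induction m generalizing g g' with
  | zero => exact h [] rfl (by simp)
  | succ m ih =>
    refine Finset.sum_congr rfl fun a _ => ?_
    by_cases ha : p a = 0
    · simp [ha]
    · congr 1
      exact ih fun l hl hl' => h _ (by simp [hl]) (by simpa using ⟨ha, hl'⟩)

theorem iid_nonneg (hp : ∀ a, 0 ≤ p a) (m : ℕ) {g : List U → ℝ} (h : ∀ l, 0 ≤ g l) :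
    0 ≤ iid p m g := by
  induction m generalizing g with
  | zero => exact h []
  | succ m ih => exact Finset.sum_nonneg fun a _ => mul_nonneg (hp a) (ih fun l => h _)

/-- The variance of a sum of independent terms. -/
theorem iid_sum_variance (hp : ∑ a, p a = 1) (f : U → ℝ) (m : ℕ) :
    iid p m (fun l => ((l.map f).sum - m * ∑ a, p a * f a) ^ 2) =
      m * ∑ a, p a * (f a - ∑ b, p b * f b) ^ 2 := by
  set μ := ∑ a, p a * f a
  -- The centred sum has mean zero, which removes the cross term in the recursion for the second
  -- moment.
  have hmean : ∀ m : ℕ, iid p m (fun l => (l.map f).sum - m * μ) = 0 := by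
    intro m
    induction m with
    | zero => simp [iid]
    | succ m ih =>
      have h : ∀ a, iid p m (fun l => ((a :: l).map f).sum - (m + 1 : ℕ) * μ) = f a - μ := by
        intro a
        rw [show (fun l : List U => ((a :: l).map f).sum - (m + 1 : ℕ) * μ) =
          fun l => (f a - μ) + ((l.map f).sum - m * μ) by
            funext l; simp only [List.map_cons, List.sum_cons]; push_cast; ring]
        rw [iid_add, ih, iid_const hp, add_zero]
      simp only [iid, h, mul_sub, Finset.sum_sub_distrib, ← Finset.sum_mul, hp, one_mul]
      exact sub_self μ
  induction m with
  | zero => simp [iid]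
  | succ m ih =>
    have h : ∀ a, iid p m (fun l => (((a :: l).map f).sum - (m + 1 : ℕ) * μ) ^ 2) =
        (f a - μ) ^ 2 + m * ∑ a, p a * (f a - μ) ^ 2 := by
      intro a
      rw [show (fun l : List U => (((a :: l).map f).sum - (m + 1 : ℕ) * μ) ^ 2) =
        fun l => ((f a - μ) ^ 2 + 2 * (f a - μ) * ((l.map f).sum - m * μ)) +
          ((l.map f).sum - m * μ) ^ 2 by
            funext l; simp only [List.map_cons, List.sum_cons]; push_cast; ring]
      rw [iid_add, iid_add, iid_mul_left, hmean, iid_const hp, ih]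
      ring
    simp only [iid, h, mul_add, Finset.sum_add_distrib, ← Finset.sum_mul, hp, one_mul]
    push_cast
    ring

variable [DecidableEq U]

omit [Fintype U] in
theorem count_eq_sum_map (l : List U) (a : U) :
    (l.count a : ℝ) = (l.map fun b => if b = a then (1 : ℝ) else 0).sum := by
  induction l with
  | nil => simp
  | cons b l ih =>
    rw [List.count_cons, List.map_cons, List.sum_cons, ← ih]
    by_cases h : b = a <;> simp [h, add_comm]

omit [Fintype U] in
theorem sum_count_eq_length (H : Finset U) (l : List U) (h : ∀ a ∈ l, a ∈ H) :
    ∑ a ∈ H, (l.count a : ℝ) = l.length := by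
  have := Multiset.sum_count_eq_card (s := H) (m := (l : Multiset U)) (by simpa using h)
  simp only [Multiset.coe_count, Multiset.coe_card] at this
  exact_mod_cast this

/-- The weighted number of collisions in a list of items. -/
noncomputable def collisions (H : Finset U) (v : U → ℝ) (l : List U) : ℝ :=
  ∑ a ∈ H, ((l.count a).choose 2 : ℝ) / v a

omit [Fintype U] in
theorem collisions_cons (H : Finset U) (v : U → ℝ) (l : List U) {a : U} (ha : a ∈ H) :
    collisions H v (a :: l) = collisions H v l + l.count a / v a := by
  unfold collisions
  rw [← Finset.sum_erase_add H _ ha, ← Finset.sum_erase_add H _ ha, add_assoc, ← add_div]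
  congr 1
  · refine Finset.sum_congr rfl fun b hb => ?_
    rw [List.count_cons_of_ne (Finset.ne_of_mem_erase hb).symm]
  · rw [List.count_cons_self, Nat.choose_succ_succ' (List.count a l) 1]
    simp [add_comm]

/-- The increments of `collisions` are uncorrelated, which bounds its variance. -/
theorem iid_collisions_variance_le {H : Finset U} {v : U → ℝ} (hv : ∀ a ∈ H, 0 < v a) {V : ℝ}
    (hV : ∑ a ∈ H, v a = V) (hVpos : 0 < V) (hpv : ∀ a, p a = if a ∈ H then v a / V else 0)
    (m : ℕ) :
    iid p m (fun l => (collisions H v l - m.choose 2 / V) ^ 2) ≤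
      m.choose 2 * (H.card / V ^ 2) := by
  have hp : ∑ a, p a = 1 := by
    simp only [hpv, Finset.sum_ite_mem, Finset.univ_inter]
    rw [← Finset.sum_div, hV, div_self hVpos.ne']
  have hpH : ∀ (g : U → ℝ), ∑ a, p a * g a = ∑ a ∈ H, v a / V * g a := by
    intro g
    simp only [hpv, ite_mul, zero_mul, Finset.sum_ite_mem, Finset.univ_inter]
  induction m with
  | zero => simp [iid, collisions]
  | succ m ih =>
    have hchoose : ((m + 1).choose 2 : ℝ) = m.choose 2 + m := by
      rw [Nat.choose_succ_succ' m 1]; push_cast; simp [add_comm]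
    let D : List U → ℝ := fun l => collisions H v l - m.choose 2 / V
    -- `D` is the current deviation and `e a` is the centred increment when the next sample is `a`:
    -- a new copy of `a` collides with each earlier one.
    let e : U → List U → ℝ := fun a l => l.count a / v a - m / V
    have h1 : iid p (m + 1) (fun l => (collisions H v l - (m + 1).choose 2 / V) ^ 2) =
        iid p m fun l => ∑ a ∈ H, v a / V * (D l + e a l) ^ 2 := by
      rw [iid_sum]
      simp only [iid]
      rw [hpH fun a => iid p m fun l => (collisions H v (a :: l) - (m + 1).choose 2 / V) ^ 2]
      refine Finset.sum_congr rfl fun a ha => ?_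
      rw [iid_mul_left]
      congr 2
      funext l
      rw [collisions_cons H v l ha, hchoose]
      simp only [D, e]
      ring
    have h2 : iid p m (fun l => ∑ a ∈ H, v a / V * (D l + e a l) ^ 2) =
        iid p m fun l => D l ^ 2 + ∑ a ∈ H, v a / V * e a l ^ 2 := by
      refine iid_congr m fun l hl hsupp => ?_
      have hlH : ∀ a ∈ l, a ∈ H := fun a ha => by
        by_contra h
        exact hsupp a ha (by rw [hpv, if_neg h])
      have hs : ∑ a ∈ H, v a / V = 1 := by rw [← Finset.sum_div, hV, div_self hVpos.ne']
      -- Given the past, the increment has mean zero: the sampling probability cancels the weight 1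
      -- / v, and the counts add up to `m`.
      have he : ∑ a ∈ H, v a / V * e a l = 0 := by
        have : ∀ a ∈ H, v a / V * e a l = l.count a / V - v a / V * (m / V) := by
          intro a ha
          have := (hv a ha).ne'
          simp only [e]
          field_simp
        rw [Finset.sum_congr rfl this, Finset.sum_sub_distrib, ← Finset.sum_div,
          ← Finset.sum_mul, hs, sum_count_eq_length H l hlH, hl]
        ring
      have : ∀ a ∈ H, v a / V * (D l + e a l) ^ 2 =
          v a / V * D l ^ 2 + 2 * D l * (v a / V * e a l) + v a / V * e a l ^ 2 := by
        intro a _; ring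
      rw [Finset.sum_congr rfl this, Finset.sum_add_distrib, Finset.sum_add_distrib,
        ← Finset.sum_mul, ← Finset.mul_sum, hs, he]
      ring
    -- Up to scaling, this is the binomial variance of the count of `a`, which is at most m·v(a) /
    -- V. The resulting bound does not depend on `a`.
    have h3 : ∀ a ∈ H, iid p m (fun l => v a / V * e a l ^ 2) ≤ m / V ^ 2 := by
      intro a ha
      have hva := hv a ha
      have hpa : p a = v a / V := by rw [hpv, if_pos ha]
      have hvar := iid_sum_variance hp (fun b => if b = a then (1 : ℝ) else 0) m
      have hμ : ∑ b, p b * (if b = a then (1 : ℝ) else 0) = p a := by simp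
      rw [hμ] at hvar
      have hle : ∑ b, p b * ((if b = a then (1 : ℝ) else 0) - p a) ^ 2 ≤ p a := by
        have : ∀ b, p b * ((if b = a then (1 : ℝ) else 0) - p a) ^ 2 =
            p b * (if b = a then 1 else 0) * (1 - 2 * p a) + p b * p a ^ 2 := by
          intro b; split_ifs <;> ring
        simp only [this, Finset.sum_add_distrib, ← Finset.sum_mul, hμ, hp]
        nlinarith [sq_nonneg (p a)]
      have : (fun l : List U => v a / V * e a l ^ 2) = fun l => 1 / (V * v a) *
          ((l.map fun b => if b = a then (1 : ℝ) else 0).sum - m * p a) ^ 2 := by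
        funext l
        rw [← count_eq_sum_map, hpa]
        simp only [e]
        field_simp
      rw [this, iid_mul_left, hvar]
      calc 1 / (V * v a) * (m * ∑ b, p b * ((if b = a then (1 : ℝ) else 0) - p a) ^ 2)
          ≤ 1 / (V * v a) * (m * p a) := by gcongr
        _ = m / V ^ 2 := by rw [hpa]; field_simp
    rw [h1, h2, iid_add, iid_sum, hchoose, add_mul]
    refine add_le_add ih ((Finset.sum_le_sum h3).trans_eq ?_)
    rw [Finset.sum_const, nsmul_eq_mul]
    ring

end Iid

/-! ### From independent samples to repeated runs -/

section Chebyshev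

variable {U I α : Type*} [Fintype U] (P Q : PMF U) (ans : U → I) {p : U → ℝ} {X : Alg I α}
  {val : U → α}

/-- Only an inequality is assumed on `X`, since rejection sampling may run out of fuel: its outputs
are then dominated by the law `p` without having it exactly. -/
theorem expect_replicate_le_iid (hp : ∀ a, 0 ≤ p a)
    (hX : ∀ f : α → ℝ≥0∞, expect P Q ans X (fun o _ => o.elim 0 f) ≤
      ∑ a, ENNReal.ofReal (p a) * f (val a)) (m : ℕ) (g : List α → ℝ≥0∞) (G : List U → ℝ)
    (hG : ∀ l, 0 ≤ G l)
    (hgG : ∀ l, l.length = m → (∀ a ∈ l, p a ≠ 0) → g (l.map val) ≤ ENNReal.ofReal (G l)) :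
    expect P Q ans (X.replicate m) (fun o _ => o.elim 0 g) ≤ ENNReal.ofReal (iid p m G) := by
  induction m generalizing g G with
  | zero => exact hgG [] rfl (by simp)
  | succ m ih =>
    simp only [Alg.replicate, iid]
    rw [expect_bind]
    calc _ ≤ expect P Q ans X (fun o _ => o.elim 0 fun x =>
          expect P Q ans (X.replicate m) fun o _ => o.elim 0 fun l => g (x :: l)) := by
          refine expect_mono P Q ans X fun o c => ?_
          cases o with
          | none => exact le_rfl
          | some x =>
            simp only [bindExpect, Option.elim]
            rw [expect_bind]
            refine expect_mono P Q ans _ fun o c => ?_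
            cases o <;> exact le_rfl
      _ ≤ _ := hX _
      _ ≤ _ := by
          rw [ENNReal.ofReal_sum_of_nonneg fun a _ =>
            mul_nonneg (hp a) (iid_nonneg hp m fun l => hG _)]
          refine Finset.sum_le_sum fun a _ => ?_
          rw [ENNReal.ofReal_mul (hp a)]
          by_cases ha : p a = 0
          · simp [ha]
          · gcongr
            exact ih _ _ (fun l => hG _) fun l hl hsupp =>
              hgG (a :: l) (by simp [hl]) (by simpa using ⟨ha, hsupp⟩)

/-- Chebyshev's inequality for a statistic of independent runs. -/
theorem failProb_replicate_chebyshev (hp : ∀ a, 0 ≤ p a)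
    (hX : ∀ f : α → ℝ≥0∞, expect P Q ans X (fun o _ => o.elim 0 f) ≤
      ∑ a, ENNReal.ofReal (p a) * f (val a)) (m : ℕ) (G : List α → Prop) (F : List U → ℝ)
    {μ V d : ℝ} (hd : 0 < d) (hV : iid p m (fun l => (F l - μ) ^ 2) ≤ V)
    (hG : ∀ l, l.length = m → (∀ a ∈ l, p a ≠ 0) → |F l - μ| ≤ d → G (l.map val)) :
    failProb P Q ans (X.replicate m) (fun l _ => G l) ≤
      failProb P Q ans (X.replicate m) (fun _ _ => True) + ENNReal.ofReal (V / d ^ 2) := by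
  classical
  have h := expect_replicate_le_iid P Q ans hp hX m (fun l => if G l then 0 else 1)
    (fun l => 1 / d ^ 2 * (F l - μ) ^ 2) (fun l => by positivity) fun l hl hsupp => by
      split_ifs with h
      · exact zero_le
      · rw [ENNReal.one_le_ofReal, one_div_mul_eq_div, one_le_div (by positivity), ← sq_abs (F l - μ)]
        have := not_le.1 (mt (hG l hl hsupp) h)
        gcongr
  rw [iid_mul_left] at h
  have h' : ENNReal.ofReal (1 / d ^ 2 * iid p m fun l => (F l - μ) ^ 2) ≤
      ENNReal.ofReal (V / d ^ 2) := by
    apply ENNReal.ofReal_le_ofReal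
    rw [one_div_mul_eq_div]
    gcongr
  refine le_trans ?_ (add_le_add_right (h.trans h') _)
  unfold failProb
  rw [← expect_add]
  refine expect_mono P Q ans _ fun o c => ?_
  cases o with
  | none => simp [failInd]
  | some l => by_cases h : G l <;> simp [failInd, h]

end Chebyshev

/-! ### Heavy items -/

section Heavy

variable {U : Type*} [Fintype U] {n : ℕ}

/-- The heavy items: those at or above the threshold `θ`. -/
noncomputable def heavy (w : U → ℝ≥0) (σ : U ≃ Fin n) (θ : Key) : Finset U :=
  {a | θ ≤ (rankedItem w σ a).key}

theorem mem_heavy {w : U → ℝ≥0} {σ : U ≃ Fin n} {θ : Key} {a : U} :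
    a ∈ heavy w σ θ ↔ θ ≤ (rankedItem w σ a).key := by
  simp [heavy]

/-- The probability that a proportional sample is heavy. -/
noncomputable def heavyMass (w : U → ℝ≥0) (σ : U ≃ Fin n) (θ : Key) : ℝ :=
  (∑ a ∈ heavy w σ θ, (w a : ℝ)) / ∑ a, (w a : ℝ)

theorem propDist_apply (w : U → ℝ≥0) (hW : ∑ a, w a ≠ 0) (a : U) :
    propDist w hW a = ENNReal.ofReal ((w a : ℝ) / ∑ b, (w b : ℝ)) := by
  rw [propDist, PMF.ofFintype_apply, ← NNReal.coe_sum, ← NNReal.coe_div, ENNReal.ofReal_coe_nnreal]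

theorem total_pos (w : U → ℝ≥0) (hW : ∑ a, w a ≠ 0) : 0 < ∑ a, (w a : ℝ) := by
  rw [← NNReal.coe_sum, NNReal.coe_pos]
  exact pos_iff_ne_zero.2 hW

variable (w : U → ℝ≥0) (hW : ∑ a, w a ≠ 0) (σ : U ≃ Fin n) (θ : Key)

include hW in
theorem heavyMass_le_one : heavyMass w σ θ ≤ 1 := by
  rw [heavyMass, div_le_one (total_pos w hW)]
  exact Finset.sum_le_sum_of_subset_of_nonneg (Finset.subset_univ _) fun _ _ _ => NNReal.coe_nonneg _

theorem sum_propDist_mul_ite (b b' : ℝ≥0∞) :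
    ∑ a, propDist w hW a * (if θ ≤ (rankedItem w σ a).key then b else b') =
      ENNReal.ofReal (heavyMass w σ θ) * b + ENNReal.ofReal (1 - heavyMass w σ θ) * b' := by
  have hWpos := total_pos w hW
  have h1 : ENNReal.ofReal (heavyMass w σ θ) =
      ∑ a, if θ ≤ (rankedItem w σ a).key then propDist w hW a else 0 := by
    rw [heavyMass, Finset.sum_div, ENNReal.ofReal_sum_of_nonneg fun a _ => by positivity,
      heavy, Finset.sum_filter]
    simp only [propDist_apply]
  have h2 : ENNReal.ofReal (1 - heavyMass w σ θ) =
      ∑ a, if θ ≤ (rankedItem w σ a).key then 0 else propDist w hW a := by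
    have : 1 - heavyMass w σ θ =
        ∑ a, if θ ≤ (rankedItem w σ a).key then 0 else (w a : ℝ) / ∑ b, (w b : ℝ) := by
      have hsplit := Finset.sum_filter_add_sum_filter_not Finset.univ
        (fun a => θ ≤ (rankedItem w σ a).key) fun a => (w a : ℝ)
      have hnot : (∑ a, if θ ≤ (rankedItem w σ a).key then 0 else (w a : ℝ) / ∑ b, (w b : ℝ)) =
          (∑ a with ¬θ ≤ (rankedItem w σ a).key, (w a : ℝ)) / ∑ b, (w b : ℝ) := by
        rw [Finset.sum_div, Finset.sum_filter]
        exact Finset.sum_congr rfl fun a _ => by split_ifs <;> simp_all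
      rw [hnot, heavyMass, heavy, eq_div_iff hWpos.ne', sub_mul, div_mul_cancel₀ _ hWpos.ne']
      linarith
    rw [this, ENNReal.ofReal_sum_of_nonneg fun a _ => by split_ifs <;> positivity]
    refine Finset.sum_congr rfl fun a _ => ?_
    rw [propDist_apply]
    split_ifs <;> simp
  rw [h1, h2, Finset.sum_mul, Finset.sum_mul, ← Finset.sum_add_distrib]
  exact Finset.sum_congr rfl fun a _ => by split_ifs <;> simp

variable [Nonempty U] [DecidableEq U]

omit [DecidableEq U] in
theorem isExperiment_propSample :
    IsExperiment (propDist w hW) (PMF.uniformOfFintype U) (rankedItem w σ)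
      (Alg.propSample.bind fun a => .ret (decide (θ ≤ a.key))) (heavyMass w σ θ) := by
  intro g
  rw [← sum_propDist_mul_ite w hW σ θ]
  simp only [Alg.propSample, Alg.bind, expect]
  exact Finset.sum_congr rfl fun a _ => by
    by_cases h : θ ≤ (rankedItem w σ a).key <;> simp [h]

theorem isExperiment_unifSample :
    IsExperiment (propDist w hW) (PMF.uniformOfFintype U) (rankedItem w σ)
      (Alg.unifSample.bind fun a => .ret (decide (θ ≤ a.key)))
      ((heavy w σ θ).card / n) := by
  intro g
  have hn : Fintype.card U = n := by simpa using Fintype.card_congr σ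
  have hn0 : 0 < n := Fintype.card_pos.trans_eq hn
  have hn' : (0 : ℝ) < n := by exact_mod_cast hn0
  have hc : (heavy w σ θ).card ≤ n := (Finset.card_le_univ _).trans_eq hn
  have hc' : ((n - (heavy w σ θ).card : ℕ) : ℝ) = n - (heavy w σ θ).card := Nat.cast_sub hc
  simp only [Alg.unifSample, Alg.bind, expect, PMF.uniformOfFintype_apply, hn]
  have h : ∀ a, (n : ℝ≥0∞)⁻¹ * g (some (decide (θ ≤ (rankedItem w σ a).key))) (0 + 1) =
      (if a ∈ heavy w σ θ then (n : ℝ≥0∞)⁻¹ * g (some true) 1 else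
        (n : ℝ≥0∞)⁻¹ * g (some false) 1) := by
    intro a
    by_cases h : θ ≤ (rankedItem w σ a).key <;> simp [mem_heavy, h]
  rw [Finset.sum_congr rfl fun a _ => h a, Finset.sum_ite, Finset.sum_const, Finset.sum_const,
    Finset.filter_mem_eq_inter, Finset.univ_inter, Finset.filter_not, Finset.filter_mem_eq_inter,
    Finset.univ_inter, ← Finset.compl_eq_univ_sdiff, Finset.card_compl, hn,
    show (1 : ℝ) - (heavy w σ θ).card / n = (n - (heavy w σ θ).card : ℕ) / n by
      rw [hc']; field_simp,
    ENNReal.ofReal_div_of_pos hn', ENNReal.ofReal_div_of_pos hn']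
  simp only [ENNReal.ofReal_natCast, nsmul_eq_mul, div_eq_mul_inv, mul_assoc]

end Heavy

/-! ### Heavy proportional samples, by rejection -/

section RepeatUntil

variable {U : Type*} [Fintype U] {I α : Type*}

/-- The number of samples, with a surcharge of `L` if the algorithm aborts. -/
noncomputable def surchargedCost (L : ℝ≥0∞) (o : Option α) (c : ℕ) : ℝ≥0∞ :=
  c + o.elim L fun _ => 0

theorem surchargedCost_add (L : ℝ≥0∞) (o : Option α) (c d : ℕ) :
    surchargedCost L o (c + d) = c + surchargedCost L o d := by
  simp [surchargedCost, add_assoc]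

theorem expect_replicate_surchargedCost_le (P Q : PMF U) (ans : U → I) (X : Alg I α)
    {L e : ℝ≥0∞} (h : expect P Q ans X (surchargedCost L) ≤ e) (m : ℕ) :
    expect P Q ans (X.replicate m) (surchargedCost L) ≤ m * e := by
  induction m with
  | zero => simp [Alg.replicate, expect, surchargedCost]
  | succ m ih =>
    simp only [Alg.replicate]
    rw [expect_bind]
    calc _ ≤ expect P Q ans X (fun o c => surchargedCost L o c + m * e) := by
          refine expect_mono P Q ans X fun o c => ?_
          cases o with
          | none => exact le_self_add
          | some x =>
            simp only [bindExpect, surchargedCost_add]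
            rw [expect_add P Q ans _ (fun _ _ => (c : ℝ≥0∞)), expect_const, expect_bind]
            simp only [surchargedCost, Option.elim, add_zero]
            gcongr
            refine le_trans (expect_mono P Q ans _ fun o d => ?_) ih
            cases o <;> simp [bindExpect, expect, surchargedCost]
      _ ≤ e + m * e := by rw [expect_add, expect_const]; gcongr
      _ = (m + 1 : ℕ) * e := by push_cast; ring

/-- Markov's inequality. The surcharge makes an abort at least as expensive as exceeding the bound,
so both are covered. -/
theorem failProb_cost_le (P Q : PMF U) (ans : U → I) (A : Alg I α) {B : ℕ} (hB : 0 < B)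
    {L e : ℝ≥0∞} (hL : B ≤ L) (h : expect P Q ans A (surchargedCost L) ≤ e) :
    failProb P Q ans A (fun _ c => c ≤ B) ≤ (B : ℝ≥0∞)⁻¹ * e := by
  refine le_trans ?_ (mul_le_mul_right h _)
  rw [← expect_mul_left]
  have hB0 : (B : ℝ≥0∞) ≠ 0 := by simpa using hB.ne'
  refine expect_mono P Q ans A fun o c => ?_
  rw [mul_comm, ← div_eq_mul_inv, ENNReal.le_div_iff_mul_le (.inl hB0) (.inl (by simp))]
  cases o with
  | none => simpa [failInd, surchargedCost] using hL.trans le_add_self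
  | some x =>
    by_cases hc : c ≤ B
    · simp [failInd, hc]
    · simp only [failInd, hc, if_false, one_mul, surchargedCost, Option.elim, add_zero]
      exact_mod_cast (not_le.1 hc).le

variable {n : ℕ} (w : U → ℝ≥0) (hW : ∑ a, w a ≠ 0) (σ : U ≃ Fin n) (θ : Key) [Nonempty U] [DecidableEq U]

omit [DecidableEq U] in
theorem expect_repeatUntil_succ (fuel : ℕ) (g : Option (Item U) → ℕ → ℝ≥0∞) :
    expect (propDist w hW) (PMF.uniformOfFintype U) (rankedItem w σ)
        (repeatUntil (fun a : Item U => θ ≤ a.key) Alg.propSample (fuel + 1)) g =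
      ∑ a, propDist w hW a * if θ ≤ (rankedItem w σ a).key then g (some (rankedItem w σ a)) 1 else
        expect (propDist w hW) (PMF.uniformOfFintype U) (rankedItem w σ)
          (repeatUntil (fun a : Item U => θ ≤ a.key) Alg.propSample fuel)
            fun o c => g o (c + 1) := by
  simp only [repeatUntil, Alg.propSample, Alg.bind, expect]
  refine Finset.sum_congr rfl fun a _ => ?_
  split_ifs <;> simp [expect]

omit [DecidableEq U] in
theorem expect_repeatUntil_surchargedCost_le (hp : 0 < heavyMass w σ θ) (fuel : ℕ) {L : ℝ}
    (hL : 0 ≤ L) :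
    expect (propDist w hW) (PMF.uniformOfFintype U) (rankedItem w σ)
        (repeatUntil (fun a : Item U => θ ≤ a.key) Alg.propSample fuel)
        (surchargedCost (ENNReal.ofReal L)) ≤
      ENNReal.ofReal (1 / heavyMass w σ θ + L * (1 - heavyMass w σ θ) ^ fuel) := by
  have hp1 := heavyMass_le_one w hW σ θ
  induction fuel with
  | zero =>
    simp only [repeatUntil, expect, surchargedCost, Nat.cast_zero, Option.elim, zero_add, pow_zero,
      mul_one]
    apply ENNReal.ofReal_le_ofReal
    have : 0 < 1 / heavyMass w σ θ := by positivity
    linarith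
  | succ fuel ih =>
    set p := heavyMass w σ θ
    have hq : 0 ≤ 1 - p := by linarith
    rw [expect_repeatUntil_succ]
    simp only [add_comm _ 1, surchargedCost_add]
    rw [expect_add _ _ _ _ (fun _ _ => ((1 : ℕ) : ℝ≥0∞)), expect_const]
    simp only [surchargedCost, Nat.cast_one, Option.elim, add_zero]
    rw [sum_propDist_mul_ite]
    refine (add_le_add_right (mul_le_mul_right (add_le_add_right ih _) _) _).trans ?_
    rw [← ENNReal.ofReal_one, ← ENNReal.ofReal_add (by norm_num) (by positivity),
      ← ENNReal.ofReal_mul hp.le, ← ENNReal.ofReal_mul hq,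
      ← ENNReal.ofReal_add (by positivity) (mul_nonneg hq (by positivity))]
    apply ENNReal.ofReal_le_ofReal
    apply le_of_eq
    rw [pow_add, pow_one]
    field_simp
    ring

omit [DecidableEq U] in
theorem expect_repeatUntil_cost_le (hp : 0 < heavyMass w σ θ) (fuel : ℕ) :
    expect (propDist w hW) (PMF.uniformOfFintype U) (rankedItem w σ)
        (repeatUntil (fun a : Item U => θ ≤ a.key) Alg.propSample fuel)
        (surchargedCost fuel) ≤ ENNReal.ofReal (2 / heavyMass w σ θ) := by
  have hp1 := heavyMass_le_one w hW σ θ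
  have h := expect_repeatUntil_surchargedCost_le w hW σ θ hp fuel (Nat.cast_nonneg fuel)
  rw [ENNReal.ofReal_natCast] at h
  refine h.trans (ENNReal.ofReal_le_ofReal ?_)
  set p := heavyMass w σ θ
  have hq : 0 ≤ 1 - p := by linarith
  -- Multiplying by (1 - p)^fuel gives (1 - p)^fuel · (1 + fuel·p) ≤ (1 - p²)^fuel ≤ 1, so the
  -- surcharge for running out of fuel adds at most 1 / p.
  have h1 : 1 + (fuel : ℝ) * p ≤ (1 + p) ^ fuel := one_add_mul_le_pow (by linarith) fuel
  have h2 : (1 - p) ^ fuel * (1 + p) ^ fuel ≤ 1 := by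
    rw [← mul_pow]
    exact pow_le_one₀ (mul_nonneg hq (by linarith)) (by nlinarith)
  have h3 : (fuel : ℝ) * (1 - p) ^ fuel ≤ 1 / p := by
    rw [le_div_iff₀ hp]
    have h4 : (1 - p) ^ fuel * (1 + fuel * p) ≤ (1 - p) ^ fuel * (1 + p) ^ fuel := by gcongr
    have h5 : 0 ≤ (1 - p) ^ fuel := by positivity
    nlinarith
  calc _ ≤ 1 / p + 1 / p := by linarith
    _ = 2 / p := by ring

/-- The law of a heavy proportional sample. -/
noncomputable def heavyLaw (a : U) : ℝ :=
  if a ∈ (heavy w σ θ).filter (fun a => w a ≠ 0) then (w a : ℝ) / ∑ b ∈ heavy w σ θ, (w b : ℝ)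
  else 0

omit [Nonempty U] in
theorem heavyLaw_nonneg (a : U) : 0 ≤ heavyLaw w σ θ a := by
  unfold heavyLaw
  split_ifs <;> positivity

/-- The conditional expectation `S` is a fixed point of one round of rejection: pS + (1 - p)S = S.
Starting from 0 at zero fuel, the iteration stays below it. -/
theorem expect_repeatUntil_le (hp : 0 < heavyMass w σ θ) (fuel : ℕ) (f : Item U → ℝ≥0∞) :
    expect (propDist w hW) (PMF.uniformOfFintype U) (rankedItem w σ)
        (repeatUntil (fun a : Item U => θ ≤ a.key) Alg.propSample fuel)
        (fun o _ => o.elim 0 f) ≤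
      ∑ a, ENNReal.ofReal (heavyLaw w σ θ a) * f (rankedItem w σ a) := by
  have hp1 := heavyMass_le_one w hW σ θ
  have hWpos := total_pos w hW
  set S := ∑ a, ENNReal.ofReal (heavyLaw w σ θ a) * f (rankedItem w σ a)
  have hS : ∑ a, propDist w hW a * (if θ ≤ (rankedItem w σ a).key then f (rankedItem w σ a) else 0)
      = ENNReal.ofReal (heavyMass w σ θ) * S := by
    rw [Finset.mul_sum]
    refine Finset.sum_congr rfl fun a _ => ?_
    rw [← mul_assoc, ← ENNReal.ofReal_mul hp.le, propDist_apply]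
    have hV : ∑ b ∈ heavy w σ θ, (w b : ℝ) ≠ 0 := fun h => by simp [heavyMass, h] at hp
    by_cases ha : θ ≤ (rankedItem w σ a).key
    · by_cases h0 : w a = 0
      · simp [heavyLaw, h0]
      · simp only [ha, if_true, heavyLaw, Finset.mem_filter, mem_heavy, h0, ne_eq,
          not_false_eq_true, and_self]
        congr 2
        rw [heavyMass]
        field_simp
    · simp [heavyLaw, mem_heavy, ha]
  induction fuel with
  | zero => simp [repeatUntil, expect]
  | succ fuel ih =>
    rw [expect_repeatUntil_succ]
    calc _ ≤ ∑ a, (propDist w hW a * (if θ ≤ (rankedItem w σ a).key then f (rankedItem w σ a) else 0)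
            + propDist w hW a * (if θ ≤ (rankedItem w σ a).key then 0 else S)) := by
          refine Finset.sum_le_sum fun a _ => ?_
          rw [← mul_add]
          gcongr
          split_ifs
          · simp
          · simpa using ih
      _ = ENNReal.ofReal (heavyMass w σ θ) * S + ENNReal.ofReal (1 - heavyMass w σ θ) * S := by
          rw [Finset.sum_add_distrib, hS, sum_propDist_mul_ite]
          simp
      _ = S := by
          rw [← add_mul, ← ENNReal.ofReal_add hp.le (by linarith)]
          simp

end RepeatUntil

/-! ### `PropEstimator` on heavy proportional samples -/

section PropEstimator

variable {U : Type*} [Fintype U] [DecidableEq U] [Nonempty U] {n : ℕ} (w : U → ℝ≥0)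
  (hW : ∑ a, w a ≠ 0) (σ : U ≃ Fin n) (θ : Key)

omit [Nonempty U] in
theorem sum_toFinset_eq_collisions (l : List U)
    (hl : ∀ a ∈ l, a ∈ (heavy w σ θ).filter fun a => w a ≠ 0) :
    ∑ s ∈ (((l.map (rankedItem w σ)).map fun x => ((x.item, x.weight) : U × ℝ≥0)).toFinset),
        ((((l.map (rankedItem w σ)).map fun x => ((x.item, x.weight) : U × ℝ≥0)).count s).choose 2 : ℝ≥0∞) /
          (s.2 : ℝ≥0∞) =
      ENNReal.ofReal (collisions ((heavy w σ θ).filter fun a => w a ≠ 0) (fun a => w a) l) := by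
  have hinj : Function.Injective fun a : U => (a, w a) := fun a b h => (Prod.ext_iff.1 h).1
  rw [List.map_map, show ((fun x : Item U => ((x.item, x.weight) : U × ℝ≥0)) ∘ rankedItem w σ) =
    fun a => (a, w a) from rfl]
  have himage : (l.map fun a => (a, w a)).toFinset = l.toFinset.image fun a => (a, w a) := by
    ext; simp
  rw [himage, Finset.sum_image hinj.injOn]
  simp only [List.count_map_of_injective l _ hinj]
  have hsub : l.toFinset ⊆ (heavy w σ θ).filter fun a => w a ≠ 0 := fun a ha =>
    hl a (List.mem_toFinset.1 ha)
  unfold collisions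
  rw [ENNReal.ofReal_sum_of_nonneg fun a _ => by positivity, ← Finset.sum_subset hsub]
  · refine Finset.sum_congr rfl fun a ha => ?_
    have : w a ≠ 0 := (Finset.mem_filter.1 (hsub ha)).2
    rw [ENNReal.ofReal_div_of_pos (NNReal.coe_pos.2 (pos_iff_ne_zero.2 this)),
      ENNReal.ofReal_natCast, ENNReal.ofReal_coe_nnreal]
  · intro a _ ha
    rw [List.mem_toFinset] at ha
    simp [List.count_eq_zero_of_not_mem ha]

omit [DecidableEq U] [Nonempty U] in
theorem sum_filter_ne_zero :
    ∑ a ∈ (heavy w σ θ).filter (fun a => w a ≠ 0), (w a : ℝ) = ∑ a ∈ heavy w σ θ, (w a : ℝ) := by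
  rw [Finset.sum_filter_of_ne]
  intro a _ h
  simpa using h

theorem failProb_propEstimator_cost_le (hp : 0 < heavyMass w σ θ) {fuel B : ℕ} (hB : 0 < B)
    (hBf : B ≤ fuel) (n' ε : ℝ) :
    failProb (propDist w hW) (PMF.uniformOfFintype U) (rankedItem w σ)
      (propEstimator (repeatUntil (fun a : Item U => θ ≤ a.key) Alg.propSample fuel) n' ε)
        (fun _ c => c ≤ B) ≤
      ENNReal.ofReal (2 * (⌈√(24 * n') / ε⌉₊ + 1) / (heavyMass w σ θ * B)) := by
  unfold propEstimator
  rw [failProb_bind_ret]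
  refine (failProb_cost_le _ _ _ _ hB (L := fuel) (by exact_mod_cast hBf)
    (expect_replicate_surchargedCost_le _ _ _ _
      (expect_repeatUntil_cost_le w hW σ θ hp fuel) _)).trans_eq ?_
  have hB' : (0 : ℝ) < B := by exact_mod_cast hB
  rw [← ENNReal.ofReal_natCast B, ← ENNReal.ofReal_inv_of_pos hB', ← ENNReal.ofReal_natCast,
    ← ENNReal.ofReal_mul (by positivity), ← ENNReal.ofReal_mul (by positivity)]
  congr 1
  push_cast
  field_simp

/-- The number of pairs is at least 12n' / δ² and |H| ≤ 2n', so Chebyshev for the collision count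
fails with probability at most |H| / (δ² (m choose 2)) ≤ 1/6. The other term bounds the probability
that rejection sampling aborts. -/
theorem failProb_propEstimator_le (hp : 0 < heavyMass w σ θ) {fuel B : ℕ} (hB : 0 < B)
    (hBf : B ≤ fuel) {n' δ : ℝ} (hn' : 0 < n') (hδ : 0 < δ) (hδ1 : δ < 1)
    (hH : ((heavy w σ θ).card : ℝ) ≤ 2 * n') :
    failProb (propDist w hW) (PMF.uniformOfFintype U) (rankedItem w σ)
      (propEstimator (repeatUntil (fun a : Item U => θ ≤ a.key) Alg.propSample fuel) n' δ)
        (fun x _ => x ∈ Set.Icc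
          (ENNReal.ofReal ((∑ a ∈ heavy w σ θ, (w a : ℝ)) / (1 + δ)))
          (ENNReal.ofReal ((∑ a ∈ heavy w σ θ, (w a : ℝ)) / (1 - δ)))) ≤
      ENNReal.ofReal (2 * (⌈√(24 * n') / δ⌉₊ + 1) / (heavyMass w σ θ * B)) +
        ENNReal.ofReal (1 / 6) := by
  have hcost := failProb_propEstimator_cost_le w hW σ θ hp hB hBf n' δ
  unfold propEstimator at hcost ⊢
  rw [failProb_bind_ret] at hcost ⊢
  set m : ℕ := ⌈√(24 * n') / δ⌉₊ + 1 with hm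
  set V := ∑ a ∈ heavy w σ θ, (w a : ℝ)
  have hVpos : 0 < V := lt_of_le_of_ne (Finset.sum_nonneg fun a _ => by positivity)
    fun h => by simp [heavyMass, V, ← h] at hp
  set H := (heavy w σ θ).filter fun a => w a ≠ 0
  have hm1 : √(24 * n') / δ ≤ m - 1 := by
    rw [hm]; push_cast; simpa using Nat.le_ceil (√(24 * n') / δ)
  have hm0 : 0 < √(24 * n') / δ := by positivity
  have hC : 12 * n' / δ ^ 2 ≤ (m.choose 2 : ℝ) := by
    rw [Nat.cast_choose_two]
    have h1 : (√(24 * n') / δ) ^ 2 ≤ ((m : ℝ) - 1) ^ 2 := by gcongr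
    rw [div_pow, Real.sq_sqrt (by positivity)] at h1
    have h2 : ((m : ℝ) - 1) ^ 2 ≤ m * (m - 1) := by nlinarith
    have h3 : 12 * n' / δ ^ 2 = (24 * n' / δ ^ 2) / 2 := by ring
    rw [h3]
    linarith
  have hCpos : (0 : ℝ) < m.choose 2 := lt_of_lt_of_le (by positivity) hC
  have hvar := iid_collisions_variance_le (p := heavyLaw w σ θ) (H := H) (v := fun a => (w a : ℝ))
    (fun a ha => NNReal.coe_pos.2 (pos_iff_ne_zero.2 (Finset.mem_filter.1 ha).2))
    (sum_filter_ne_zero w σ θ) hVpos (fun a => rfl) m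
  refine (failProb_replicate_chebyshev (p := heavyLaw w σ θ) (val := rankedItem w σ) _ _ _
    (heavyLaw_nonneg w σ θ) (expect_repeatUntil_le w hW σ θ hp fuel) m _
    (collisions H fun a => (w a : ℝ)) (d := δ * (m.choose 2 / V)) (by positivity) hvar ?_).trans ?_
  · intro l hl hsupp hdev
    have hlH : ∀ a ∈ l, a ∈ H := fun a ha => by
      by_contra h
      exact hsupp a ha (if_neg h)
    rw [sum_toFinset_eq_collisions w σ θ l hlH]
    set Z := collisions H (fun a => (w a : ℝ)) l
    rw [abs_le] at hdev
    have hδ' : 0 < 1 - δ := by linarith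
    have h1 : (1 - δ) * (m.choose 2 / V) ≤ Z := by linarith
    have h2 : Z ≤ (1 + δ) * (m.choose 2 / V) := by linarith
    have hZ : 0 < Z := lt_of_lt_of_le (by positivity) h1
    rw [← ENNReal.ofReal_natCast, ← ENNReal.ofReal_div_of_pos hZ]
    constructor
    · apply ENNReal.ofReal_le_ofReal
      rw [div_le_div_iff₀ (by positivity) hZ]
      calc V * Z ≤ V * ((1 + δ) * (m.choose 2 / V)) := by gcongr
        _ = _ := by field_simp
    · apply ENNReal.ofReal_le_ofReal
      rw [div_le_div_iff₀ hZ hδ']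
      calc (m.choose 2 : ℝ) * (1 - δ) = V * ((1 - δ) * (m.choose 2 / V)) := by field_simp
        _ ≤ _ := by gcongr
  · refine add_le_add ((failProb_mono _ _ _ _ fun _ _ _ => trivial).trans hcost)
      (ENNReal.ofReal_le_ofReal ?_)
    have hHc : (H.card : ℝ) ≤ 2 * n' :=
      le_trans (by exact_mod_cast Finset.card_filter_le _ _) hH
    rw [show (m.choose 2 : ℝ) * (H.card / V ^ 2) / (δ * (m.choose 2 / V)) ^ 2 =
      H.card / (δ ^ 2 * m.choose 2) by field_simp, div_le_div_iff₀ (by positivity) (by norm_num)]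
    rw [div_le_iff₀ (by positivity)] at hC
    linarith

end PropEstimator

/-! ### `HarmonicEstimator` -/

section Harmonic

variable {U : Type*} [Fintype U] [DecidableEq U] [Nonempty U] {n : ℕ} (w : U → ℝ≥0)
  (hW : ∑ a, w a ≠ 0) (σ : U ≃ Fin n) (θ : Key)

theorem ceil_amplify_nine_tenths : ⌈4 / (1 - (9 / 10 : ℝ))⌉₊ = 40 := by
  rw [show (4 / (1 - (9 / 10 : ℝ))) = ((40 : ℕ) : ℝ) by norm_num, Nat.ceil_natCast]

theorem ceil_amplify_nineteen_twentieths : ⌈4 / (1 - (19 / 20 : ℝ))⌉₊ = 80 := by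
  rw [show (4 / (1 - (19 / 20 : ℝ))) = ((80 : ℕ) : ℝ) by norm_num, Nat.ceil_natCast]

theorem median_tail_le (s : ℕ) (hs : 40 ≤ s) :
    (2⁻¹ ^ (s + 1) * (4 / 3) ^ (2 * s + 1) : ℝ≥0∞) ≤ ENNReal.ofReal (1 / 100) := by
  have h : (2⁻¹ ^ (s + 1) * (4 / 3) ^ (2 * s + 1) : ℝ≥0∞) =
      ENNReal.ofReal (2⁻¹ ^ (s + 1) * (4 / 3) ^ (2 * s + 1)) := by
    rw [ENNReal.ofReal_mul (by positivity), ENNReal.ofReal_pow (by norm_num),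
      ENNReal.ofReal_pow (by norm_num), ENNReal.ofReal_inv_of_pos (by norm_num),
      ENNReal.ofReal_div_of_pos (by norm_num)]
    simp
  rw [h]
  apply ENNReal.ofReal_le_ofReal
  -- Each increase of `s` by one contributes the factor (1/2) · (4/3)² = 8/9.
  calc (2⁻¹ ^ (s + 1) * (4 / 3) ^ (2 * s + 1) : ℝ) = 2 / 3 * (8 / 9) ^ s := by
        rw [pow_succ, pow_succ, pow_mul, mul_mul_mul_comm, ← mul_pow]; norm_num; ring
    _ ≤ 2 / 3 * (8 / 9) ^ 40 := by
        gcongr ?_ * ?_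
        exact pow_le_pow_of_le_one (by norm_num) (by norm_num) hs
    _ ≤ 1 / 100 := by norm_num

omit [DecidableEq U] in
theorem failProb_replicate_propSample (m : ℕ) :
    failProb (propDist w hW) (PMF.uniformOfFintype U) (rankedItem w σ)
      (Alg.propSample.replicate m) (fun _ c => c ≤ m) = 0 := by
  have h := failProb_replicate_all (propDist w hW) (PMF.uniformOfFintype U) (rankedItem w σ)
    Alg.propSample (fun _ => True) 1 (δ := 0)
    (by simp [failProb, Alg.propSample, expect, failInd]) m
  rw [mul_zero, nonpos_iff_eq_zero] at h
  rw [← nonpos_iff_eq_zero, ← h]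
  exact failProb_mono _ _ _ _ fun l c hc => by simpa using hc.2.2

omit [DecidableEq U] in
theorem expect_propSample (f : Item U → ℝ≥0∞) :
    expect (propDist w hW) (PMF.uniformOfFintype U) (rankedItem w σ) Alg.propSample
      (fun o _ => o.elim 0 f) =
      ∑ a, ENNReal.ofReal ((w a : ℝ) / ∑ b, (w b : ℝ)) * f (rankedItem w σ a) := by
  simp [Alg.propSample, expect, propDist_apply]

variable {ε : ℝ}

theorem harmonic_sample_count (hθ : 0 < θ.weight) (p : ℝ≥0) :
    45 * ((3 * θ.weight : ℝ≥0) : ℝ) / ((θ.weight : ℝ) * (1 - ε / 3) * p * ε ^ 2) =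
      135 / ((1 - ε / 3) * p * ε ^ 2) := by
  have : (θ.weight : ℝ) ≠ 0 := by exact_mod_cast hθ.ne'
  push_cast
  rw [show (45 * (3 * (θ.weight : ℝ))) = θ.weight * 135 by ring,
    show (θ.weight : ℝ) * (1 - ε / 3) * p * ε ^ 2 = θ.weight * ((1 - ε / 3) * p * ε ^ 2) by ring,
    mul_div_mul_left _ _ this]

/-- The number of proportional samples is inversely proportional to the estimate of |H| / n, so its
cost needs only the crude lower bound p / 101. This holds for all 81 runs with failure probability
81 / (108 · 100²), which survives the outer amplification; the 1/100 tail of an accurate median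
would not. -/
theorem failProb_harmonicEstimator_cost_le (hθ : 0 < θ.weight) (hH : 0 < (heavy w σ θ).card)
    (hε : 0 < ε) (hε1 : ε < 1) {fuel B₁ B₂ : ℕ}
    (hB₁ : 109 * 101 / (ε ^ 2 * ((heavy w σ θ).card / n)) ≤ B₁) (hBf : B₁ ≤ fuel)
    (hB₂ : 20454 / (ε ^ 2 * ((heavy w σ θ).card / n)) ≤ B₂) :
    failProb (propDist w hW) (PMF.uniformOfFintype U) (rankedItem w σ)
      (harmonicEstimator fuel ε (3 * θ.weight) θ) (fun _ c => c ≤ 81 * B₁ + B₂) ≤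
      ENNReal.ofReal (81 / 1080000) := by
  have hcard : Fintype.card U = n := by simpa using Fintype.card_congr σ
  have hn : 0 < n := Fintype.card_pos.trans_eq hcard
  have hcn : (heavy w σ θ).card ≤ n := (Finset.card_le_univ _).trans_eq hcard
  set p : ℝ := (heavy w σ θ).card / n with hpdef
  have hp : 0 < p := by positivity
  have hp1 : p ≤ 1 := by
    rw [hpdef, div_le_one (by exact_mod_cast hn)]
    exact_mod_cast hcn
  have hε2 : ε ^ 2 * p ≤ 1 := mul_le_one₀ (pow_le_one₀ hε.le hε1.le) hp.le hp1
  unfold harmonicEstimator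
  have h1 := failProb_amplify_all _ _ _ _ _ _
    (failProb_bernoulliEstimator_cost_le _ _ _ (isExperiment_unifSample w hW σ θ) hp hp1 hε hε1
      (K := 101) (by norm_num) hB₁ hBf) (9 / 10)
  rw [ceil_amplify_nine_tenths] at h1
  have h2 : ((2 * 40 + 1 : ℕ) : ℝ≥0∞) * ENNReal.ofReal (1 / (108 * (101 - 1) ^ 2)) =
      ENNReal.ofReal (81 / 1080000) := by
    rw [← ENNReal.ofReal_natCast, ← ENNReal.ofReal_mul (by positivity)]
    norm_num
  rw [h2] at h1
  rw [← add_zero (ENNReal.ofReal (81 / 1080000))]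
  refine failProb_bind_le _ _ _ _ _ _ _ h1 fun x c hx => ?_
  simp only
  rw [failProb_bind_ret, harmonic_sample_count θ hθ]
  refine (failProb_mono _ _ _ _ fun l d hd => ?_).trans_eq
    (failProb_replicate_propSample w hW σ _)
  have hxp : p / 101 ≤ x := by
    have := hx.1
    rwa [Real.toNNReal_le_iff_le_coe] at this
  have hx0 : (0 : ℝ) < x := lt_of_lt_of_le (by positivity) hxp
  have hk : (⌈135 / ((1 - ε / 3) * x * ε ^ 2)⌉₊ : ℝ) ≤ B₂ := by
    refine (Nat.ceil_lt_add_one ?_).le.trans (le_trans ?_ hB₂)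
    · have : 0 < 1 - ε / 3 := by linarith
      positivity
    -- This is where 20454 comes from: 135 · 101 · 3/2 = 20452.5, plus at most one unit for the
    -- ceiling.
    · have h3 : 135 / ((1 - ε / 3) * x * ε ^ 2) ≤ 135 / ((2 / 3) * (p / 101) * ε ^ 2) := by
        have h23 : (2 / 3 : ℝ) ≤ 1 - ε / 3 := by linarith
        gcongr
      have h4 : (1 : ℝ) ≤ 1 / (ε ^ 2 * p) := by rwa [one_le_div (by positivity)]
      have h5 : 135 / ((2 / 3) * (p / 101) * ε ^ 2) = 20452.5 * (1 / (ε ^ 2 * p)) := by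
        field_simp
        norm_num
      have h6 : 20454 / (ε ^ 2 * p) = 20454 * (1 / (ε ^ 2 * p)) := by ring
      rw [h6]
      linarith
  have hk' : ⌈135 / ((1 - ε / 3) * x * ε ^ 2)⌉₊ ≤ B₂ := by exact_mod_cast hk
  have := hx.2
  omega

omit [DecidableEq U] [Nonempty U] in
include hW in
/-- Mean and second moment of one term of the harmonic average. -/
theorem harmonic_moments (hθ : 0 < θ.weight) :
    ∑ a, (w a : ℝ) / (∑ b, (w b : ℝ)) * (if θ ≤ (rankedItem w σ a).key then (w a : ℝ)⁻¹ else 0) =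
      (heavy w σ θ).card / ∑ b, (w b : ℝ) ∧
    ∑ a, (w a : ℝ) / (∑ b, (w b : ℝ)) *
        (if θ ≤ (rankedItem w σ a).key then (w a : ℝ)⁻¹ else 0) ^ 2 ≤
      (heavy w σ θ).card / (θ.weight * ∑ b, (w b : ℝ)) := by
  have hWpos := total_pos w hW
  have hle : ∀ a, θ ≤ (rankedItem w σ a).key → (θ.weight : ℝ) ≤ w a := by
    intro a ha
    exact_mod_cast Prod.Lex.monotone_fst _ _ ha
  have hθ' : (0 : ℝ) < θ.weight := by exact_mod_cast hθ
  constructor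
  · rw [Finset.card_eq_sum_ones, Nat.cast_sum, Finset.sum_div, heavy, Finset.sum_filter]
    refine Finset.sum_congr rfl fun a _ => ?_
    split_ifs with h
    · have := hθ'.trans_le (hle a h)
      push_cast
      field_simp
    · simp
  · rw [Finset.card_eq_sum_ones, Nat.cast_sum, Finset.sum_div, heavy, Finset.sum_filter]
    refine Finset.sum_le_sum fun a _ => ?_
    split_ifs with h
    · have h0 := hθ'.trans_le (hle a h)
      have : (w a : ℝ) / (∑ b, (w b : ℝ)) * ((w a : ℝ)⁻¹) ^ 2 = 1 / (w a * ∑ b, (w b : ℝ)) := by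
        field_simp
      rw [this, Nat.cast_one]
      gcongr
      exact hle a h
    · simp

omit [Fintype U] [DecidableEq U] [Nonempty U] in
theorem harmonic_sum (hθ : 0 < θ.weight) (l : List U) :
    (List.map (fun a : Item U => if θ ≤ a.key then (a.weight : ℝ≥0∞)⁻¹ else 0)
      (l.map (rankedItem w σ))).sum = ENNReal.ofReal
        (l.map fun a => if θ ≤ (rankedItem w σ a).key then (w a : ℝ)⁻¹ else 0).sum := by
  rw [List.map_map]
  induction l with
  | nil => simp
  | cons a l ih =>
    rw [List.map_cons, List.sum_cons, List.map_cons, List.sum_cons, ih, ENNReal.ofReal_add]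
    · congr 1
      simp only [Function.comp]
      split_ifs with h
      · have h0 : 0 < w a := hθ.trans_le (Prod.Lex.monotone_fst _ _ h)
        rw [ENNReal.ofReal_inv_of_pos (by exact_mod_cast h0), ENNReal.ofReal_coe_nnreal]
        rfl
      · simp
    · split_ifs <;> positivity
    · refine List.sum_nonneg fun y hy => ?_
      obtain ⟨b, -, rfl⟩ := List.mem_map.1 hy
      split_ifs <;> positivity

/-- The errors of numerator and denominator combine to a factor within 1 ± ε. This uses the accuracy
ε/6 of the estimate of p: an interval p / (1 ± ε/3) would be too wide for ε near 1. -/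
theorem harmonic_output_bounds {ε p x k n W μ F : ℝ} (hε : 0 < ε) (hε1 : ε < 1) (hp : 0 < p)
    (hx0 : 0 < x) (hk0 : 0 < k) (hn : 0 < n) (hW : 0 < W) (hx1 : p / (1 + ε / 6) ≤ x)
    (hx2 : x ≤ p / (1 - ε / 6)) (hμ : μ = p * n / W) (hF1 : (1 - ε / 3) * (k * μ) ≤ F)
    (hF2 : F ≤ (1 + ε / 3) * (k * μ)) :
    (1 - ε) * W / n ≤ x / (F / k) ∧ x / (F / k) ≤ (1 + ε) * W / n := by
  have e3 : 0 < 1 - ε / 3 := by linarith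
  have e6 : 0 < 1 - ε / 6 := by linarith
  have e1 : 0 < 1 - ε := by linarith
  have hμ0 : 0 < μ := by rw [hμ]; positivity
  have hF0 : 0 < F := lt_of_lt_of_le (by positivity) hF1
  rw [div_le_iff₀ (by positivity)] at hx1
  rw [le_div_iff₀ e6] at hx2
  rw [div_div_eq_mul_div]
  constructor
  · rw [div_le_div_iff₀ hn hF0]
    have h : (1 - ε) * ((1 + ε / 6) * (1 + ε / 3)) ≤ 1 := by
      nlinarith [mul_pos hε hε, mul_pos (mul_pos hε hε) hε]
    calc (1 - ε) * W * F ≤ (1 - ε) * W * ((1 + ε / 3) * (k * μ)) := by gcongr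
      _ = (1 - ε) * (1 + ε / 3) * k * n * p := by rw [hμ]; field_simp
      _ ≤ (1 - ε) * (1 + ε / 3) * k * n * (x * (1 + ε / 6)) := by gcongr
      _ = ((1 - ε) * ((1 + ε / 6) * (1 + ε / 3))) * (x * k * n) := by ring
      _ ≤ 1 * (x * k * n) := by gcongr
      _ = _ := by ring
  · rw [div_le_div_iff₀ hF0 hn]
    have h : 1 ≤ (1 + ε) * ((1 - ε / 6) * (1 - ε / 3)) := by
      nlinarith [mul_pos hε hε, mul_pos (mul_pos hε hε) hε, mul_pos (mul_pos hε hε) e1]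
    calc x * k * n = 1 * (x * k * n) := by ring
      _ ≤ (1 + ε) * ((1 - ε / 6) * (1 - ε / 3)) * (x * k * n) := by gcongr
      _ = (1 + ε) * (1 - ε / 3) * k * n * (x * (1 - ε / 6)) := by ring
      _ ≤ (1 + ε) * (1 - ε / 3) * k * n * p := by gcongr
      _ = (1 + ε) * W * ((1 - ε / 3) * (k * μ)) := by rw [hμ]; field_simp
      _ ≤ _ := by gcongr

theorem failProb_harmonicEstimator_le (hθ : 0 < θ.weight) (hH : 0 < (heavy w σ θ).card)
    (hθW : ∑ a, (w a : ℝ) ≤ 3 * n * θ.weight)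
    (hε : 0 < ε) (hε1 : ε < 1) {fuel : ℕ}
    (hB : 109 * 101 / (ε ^ 2 * ((heavy w σ θ).card / n)) ≤ fuel) :
    failProb (propDist w hW) (PMF.uniformOfFintype U) (rankedItem w σ)
      (harmonicEstimator fuel ε (3 * θ.weight) θ) (fun x _ => x ∈ Set.Icc
        (ENNReal.ofReal ((1 - ε) * (∑ a, (w a : ℝ)) / n))
        (ENNReal.ofReal ((1 + ε) * (∑ a, (w a : ℝ)) / n))) ≤ 1 / 3 := by
  have hcard : Fintype.card U = n := by simpa using Fintype.card_congr σ
  have hn : 0 < n := Fintype.card_pos.trans_eq hcard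
  have hcn : (heavy w σ θ).card ≤ n := (Finset.card_le_univ _).trans_eq hcard
  have hWpos := total_pos w hW
  obtain ⟨hmean, hsecond⟩ := harmonic_moments w hW σ θ hθ
  set W := ∑ a, (w a : ℝ) with hWdef
  set p : ℝ := (heavy w σ θ).card / n with hpdef
  have hp : 0 < p := by positivity
  have hp1 : p ≤ 1 := by
    rw [hpdef, div_le_one (by exact_mod_cast hn)]
    exact_mod_cast hcn
  have hθ' : (0 : ℝ) < θ.weight := by exact_mod_cast hθ
  have hn' : (0 : ℝ) < n := by exact_mod_cast hn
  have e3 : 0 < 1 - ε / 3 := by linarith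
  have e6 : 0 < 1 - ε / 6 := by linarith
  unfold harmonicEstimator
  have hB' : 218 / (ε ^ 2 * p) ≤ fuel := le_trans (by gcongr; norm_num) hB
  have hexp := isExperiment_unifSample w hW σ θ
  have h1 := failProb_amplify_le _ _ _ _ _ _ _
    (failProb_bernoulliEstimator_le _ _ _ hexp hp hp1 hε hε1 hB')
    ((failProb_mono _ _ _ _ fun _ _ h => h.2).trans
      (failProb_bernoulliEstimator_cost_le _ _ _ hexp hp hp1 hε hε1
        (K := 101) (by norm_num) hB le_rfl)) (9 / 10)
  rw [ceil_amplify_nine_tenths] at h1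
  have h2 : ((2 * 40 + 1 : ℕ) : ℝ≥0∞) * ENNReal.ofReal (1 / (108 * (101 - 1) ^ 2)) =
      ENNReal.ofReal (81 / 1080000) := by
    rw [← ENNReal.ofReal_natCast, ← ENNReal.ofReal_mul (by positivity)]
    norm_num
  rw [h2] at h1
  have h3 := h1.trans (add_le_add_right (median_tail_le 40 le_rfl) _)
  refine (failProb_bind_le _ _ _ _ _ _ _ (δ' := ENNReal.ofReal (1 / 5)) h3
    fun x c hx => ?_).trans ?_
  · simp only
    rw [failProb_bind_ret, harmonic_sample_count θ hθ]
    set k := ⌈135 / ((1 - ε / 3) * x * ε ^ 2)⌉₊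
    obtain ⟨⟨hx1, hx2⟩, -⟩ := hx
    rw [Real.toNNReal_le_iff_le_coe] at hx1
    rw [← NNReal.coe_le_coe, Real.coe_toNNReal _ (by positivity)] at hx2
    have hx0 : (0 : ℝ) < x := lt_of_lt_of_le (by positivity) hx1
    -- The factor 1 - ε/3 in the sample size compensates for a possible overestimate of `p`.
    have hk : 135 / (ε ^ 2 * p) ≤ (k : ℝ) := by
      refine le_trans ?_ (Nat.le_ceil _)
      apply div_le_div_of_nonneg_left (by norm_num) (by positivity)
      rw [le_div_iff₀ e6] at hx2
      have : (1 - ε / 3) * (x : ℝ) ≤ p := by nlinarith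
      nlinarith [sq_nonneg ε]
    have hk0 : (0 : ℝ) < k := lt_of_lt_of_le (by positivity) hk
    let f : U → ℝ := fun a => if θ ≤ (rankedItem w σ a).key then (w a : ℝ)⁻¹ else 0
    have hP1 : ∑ a, (w a : ℝ) / W = 1 := by rw [← Finset.sum_div, div_self hWpos.ne']
    have hvar := iid_sum_variance hP1 f k
    set μ : ℝ := (heavy w σ θ).card / W with hμ
    have hμ0 : 0 < μ := by positivity
    have hmean' : ∑ a, (w a : ℝ) / W * f a = μ := hmean
    rw [hmean'] at hvar
    have hvar' : ∑ a, (w a : ℝ) / W * (f a - μ) ^ 2 ≤ (heavy w σ θ).card / (θ.weight * W) := by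
      refine le_trans ?_ hsecond
      have : ∀ a, (w a : ℝ) / W * (f a - μ) ^ 2 =
          (w a : ℝ) / W * f a ^ 2 - 2 * μ * ((w a : ℝ) / W * f a) + μ ^ 2 * ((w a : ℝ) / W) := by
        intro a; ring
      simp only [this, Finset.sum_add_distrib, Finset.sum_sub_distrib, ← Finset.mul_sum, hmean',
        hP1]
      simp only [f]
      nlinarith [sq_nonneg μ]
    refine (failProb_replicate_chebyshev (val := rankedItem w σ) _ _ _
      (fun a => by positivity) (fun f => (expect_propSample w hW σ f).le) k _
      (fun l => (l.map f).sum) (d := ε / 3 * (k * μ)) (by positivity)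
      (hvar.le.trans (mul_le_mul_of_nonneg_left hvar' hk0.le)) ?_).trans ?_
    · intro l _ _ hdev
      rw [abs_le] at hdev
      set F := (l.map f).sum
      have hF1 : (1 - ε / 3) * (k * μ) ≤ F := by linarith
      have hF2 : F ≤ (1 + ε / 3) * (k * μ) := by linarith
      have hF0 : 0 < F := lt_of_lt_of_le (by positivity) hF1
      rw [harmonic_sum w σ θ hθ l, ← ENNReal.ofReal_natCast, ← ENNReal.ofReal_div_of_pos hk0,
        ← ENNReal.ofReal_coe_nnreal (p := x), ← ENNReal.ofReal_div_of_pos (by positivity)]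
      obtain ⟨h6, h7⟩ := harmonic_output_bounds hε hε1 hp hx0 hk0 hn' hWpos hx1 hx2
        (show μ = p * n / W by rw [hμ, hpdef]; field_simp) hF1 hF2
      exact ⟨ENNReal.ofReal_le_ofReal h6, ENNReal.ofReal_le_ofReal h7⟩
    · have h0 : failProb (propDist w hW) (PMF.uniformOfFintype U) (rankedItem w σ)
          (Alg.propSample.replicate k) (fun _ _ => True) = 0 :=
        le_antisymm ((failProb_mono _ _ _ _ fun _ _ _ => trivial).trans_eq
          (failProb_replicate_propSample w hW σ k)) zero_le
      rw [h0, zero_add]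
      apply ENNReal.ofReal_le_ofReal
      -- With W ≤ 3nθ and k ≥ 135 / (ε²p), the Chebyshev ratio is at most 27 / 135 = 1/5.
      have h4 : (k : ℝ) * ((heavy w σ θ).card / (θ.weight * W)) / (ε / 3 * (k * μ)) ^ 2 =
          9 * W / (ε ^ 2 * p * n * θ.weight * k) := by
        rw [hμ, hpdef]
        field_simp
        ring
      rw [h4, div_le_div_iff₀ (by positivity) (by norm_num)]
      rw [div_le_iff₀ (by positivity)] at hk
      have h5 : 0 < (n : ℝ) * θ.weight := by positivity
      nlinarith
  · rw [← ENNReal.ofReal_add (by norm_num) (by norm_num),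
      ← ENNReal.ofReal_add (by norm_num) (by norm_num),
      show (1 / 3 : ℝ≥0∞) = ENNReal.ofReal (1 / 3) by
        rw [ENNReal.ofReal_div_of_pos (by norm_num)]; simp]
    exact ENNReal.ofReal_le_ofReal (by norm_num)

end Harmonic

/-! ### The threshold -/

section Threshold

variable {U : Type*} [Fintype U] [DecidableEq U] {n : ℕ} (w : U → ℝ≥0) (σ : U ≃ Fin n)

omit [Fintype U] [DecidableEq U] in
theorem key_injective : Function.Injective fun a => (rankedItem w σ a).key := by
  intro a b h
  have : (σ a : ℕ) = σ b := congrArg (fun k : Key => (ofLex k).2) h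
  exact σ.injective (Fin.ext this)

/-- The set of the `t` largest items. -/
theorem exists_top (t : ℕ) (ht : t ≤ Fintype.card U) :
    ∃ T : Finset U, T.card = t ∧ ∀ a ∈ T, ∀ b ∉ T,
      (rankedItem w σ b).key < (rankedItem w σ a).key := by
  induction t with
  | zero => exact ⟨∅, by simp⟩
  | succ t ih =>
    obtain ⟨T, hT, htop⟩ := ih (by omega)
    have hne : Tᶜ.Nonempty := by
      rw [← Finset.card_pos, Finset.card_compl]
      omega
    obtain ⟨c, hc, hmax⟩ := Finset.exists_max_image Tᶜ (fun a => (rankedItem w σ a).key) hne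
    rw [Finset.mem_compl] at hc
    refine ⟨insert c T, by rw [Finset.card_insert_of_notMem hc, hT], ?_⟩
    intro a ha b hb
    rw [Finset.mem_insert, not_or] at hb
    rcases Finset.mem_insert.1 ha with rfl | ha
    · exact lt_of_le_of_ne (hmax b (by simpa using hb.2)) fun h => hb.1 (key_injective w σ h)
    · exact htop a ha b hb.2

/-- Once `k` samples lie in a top set `T`, the `k`-th largest sample exceeds every item outside `T`.
-/
theorem heavy_subset_of_le_countP {T : Finset U} (htop : ∀ a ∈ T, ∀ b ∉ T,
    (rankedItem w σ b).key < (rankedItem w σ a).key) (l : List (Item U))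
    (hl : ∀ x ∈ l, x = rankedItem w σ x.item) {k : ℕ} (hk : 0 < k)
    (hcount : k ≤ l.countP fun x => decide (x.item ∈ T)) :
    heavy w σ (kthLargest k (l.map Item.key)) ⊆ T := by
  intro b hb
  by_contra hbT
  rw [mem_heavy] at hb
  refine absurd hb (not_le.2 ?_)
  rw [kthLargest_iff (fun x => (rankedItem w σ b).key < x) (fun x y hxy hx => hx.trans_le hxy) _ _ hk
    (by rw [List.length_map]; exact hcount.trans List.countP_le_length), List.countP_map]
  refine hcount.trans (List.countP_mono_left fun x hx h => ?_)
  simp only [Function.comp, decide_eq_true_eq] at h ⊢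
  rw [hl x hx]
  exact htop _ h _ hbT

/-- Top sets are nested, so a heavy set no larger than `T` lies inside `T`; and `k` samples are
heavy by the choice of the threshold. -/
theorem le_countP_of_card_heavy_le {T : Finset U} (htop : ∀ a ∈ T, ∀ b ∉ T,
    (rankedItem w σ b).key < (rankedItem w σ a).key) (l : List (Item U))
    (hl : ∀ x ∈ l, x = rankedItem w σ x.item) {k : ℕ} (hk : 0 < k) (hkl : k ≤ l.length)
    (hcard : (heavy w σ (kthLargest k (l.map Item.key))).card ≤ T.card) :
    k ≤ l.countP fun x => decide (x.item ∈ T) := by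
  set θ := kthLargest k (l.map Item.key) with hθ
  have hsub : heavy w σ θ ⊆ T := by
    intro b hb
    by_contra hbT
    have hss : T ⊂ heavy w σ θ := by
      refine ⟨fun a ha => ?_, fun h => hbT (h hb)⟩
      rw [mem_heavy] at hb ⊢
      exact hb.trans (htop a ha b hbT).le
    exact absurd (Finset.card_lt_card hss) (not_lt.2 hcard)
  have h := (kthLargest_iff (fun x => θ ≤ x) (fun x y hxy hx => hx.trans hxy) (l.map Item.key) k hk
    (by simpa using hkl)).1 le_rfl
  rw [List.countP_map] at h
  refine h.trans (List.countP_mono_left fun x hx h => ?_)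
  simp only [Function.comp, decide_eq_true_eq] at h ⊢
  rw [hl x hx] at h
  exact hsub (mem_heavy.2 h)

variable [Nonempty U] (hW : ∑ a, w a ≠ 0)

omit [DecidableEq U] in
theorem failProb_replicate_unifSample (m : ℕ) :
    failProb (propDist w hW) (PMF.uniformOfFintype U) (rankedItem w σ)
      (Alg.unifSample.replicate m)
      (fun l c => l.length = m ∧ (∀ x ∈ l, x = rankedItem w σ x.item) ∧ c ≤ m) = 0 := by
  have h := failProb_replicate_all (propDist w hW) (PMF.uniformOfFintype U) (rankedItem w σ)
    Alg.unifSample (fun x => x = rankedItem w σ x.item) 1 (δ := 0)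
    (by simp [failProb, Alg.unifSample, expect, failInd, rankedItem]) m
  rw [mul_zero, nonpos_iff_eq_zero] at h
  rw [← nonpos_iff_eq_zero, ← h]
  exact failProb_mono _ _ _ _ fun l c hc => by simpa using hc

theorem expect_unifSample_ite (T : Finset U) {r : ℝ} (hr : 0 ≤ r) :
    expect (propDist w hW) (PMF.uniformOfFintype U) (rankedItem w σ) Alg.unifSample
      (fun o _ => o.elim 0 fun x : Item U => if x.item ∈ T then ENNReal.ofReal r else 1) =
      ENNReal.ofReal (1 + T.card / n * (r - 1)) := by
  have hcard : Fintype.card U = n := by simpa using Fintype.card_congr σ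
  have hn : 0 < n := Fintype.card_pos.trans_eq hcard
  have hn' : (0 : ℝ) < n := by exact_mod_cast hn
  have h1 : (1 + T.card / n * (r - 1) : ℝ) = ∑ a, (n : ℝ)⁻¹ * (if a ∈ T then r else 1) := by
    have : ∀ a, (n : ℝ)⁻¹ * (if a ∈ T then r else 1) =
        (n : ℝ)⁻¹ + (n : ℝ)⁻¹ * if a ∈ T then r - 1 else 0 := by
      intro a; split_ifs <;> ring
    simp only [this, Finset.sum_add_distrib, ← Finset.mul_sum, Finset.sum_ite_mem,
      Finset.univ_inter, Finset.sum_const, Finset.card_univ, hcard, nsmul_eq_mul]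
    field_simp
  rw [h1, ENNReal.ofReal_sum_of_nonneg fun a _ => by split_ifs <;> positivity]
  simp only [Alg.unifSample, expect, Option.elim, PMF.uniformOfFintype_apply, hcard]
  refine Finset.sum_congr rfl fun a _ => ?_
  rw [ENNReal.ofReal_mul (by positivity), ENNReal.ofReal_inv_of_pos hn', ENNReal.ofReal_natCast]
  by_cases h : a ∈ T <;> simp [h, rankedItem]

variable {ε x : ℝ}

/-- Among about 120x samples, about 480 fall into the top 4n / x items and about 60 into the top n /
(2x). A bad threshold needs fewer than 180 in the first set or at least 180 in the second, and
Chernoff bounds exclude both. -/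
theorem failProb_findThreshold_le (hx : (n : ℝ) ^ (1 / 3 : ℝ) * ε ^ (2 / 3 : ℝ) = x) (hx4 : 4 ≤ x)
    (hxn : 16 * x ≤ n) :
    failProb (propDist w hW) (PMF.uniformOfFintype U) (rankedItem w σ) (findThreshold n ε)
      (fun θ c => (n / (2 * x) ≤ ((heavy w σ θ).card : ℝ) ∧ ((heavy w σ θ).card : ℝ) ≤ 4 * n / x) ∧
        c ≤ ⌈120 * x⌉₊) ≤ ENNReal.ofReal (1 / 100) := by
  have hcard : Fintype.card U = n := by simpa using Fintype.card_congr σ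
  have hx0 : 0 < x := by linarith
  have hn' : (0 : ℝ) < n := by linarith
  unfold findThreshold
  rw [failProb_bind_ret, show 120 * (n : ℝ) ^ (1 / 3 : ℝ) * ε ^ (2 / 3 : ℝ) = 120 * x by
    rw [← hx]; ring]
  set m := ⌈120 * x⌉₊
  have hm1 : 120 * x ≤ m := Nat.le_ceil _
  have hm2 : (m : ℝ) ≤ 120 * x + 1 := (Nat.ceil_lt_add_one (by positivity)).le
  have hm180 : 180 ≤ m := by
    have : (180 : ℝ) ≤ m := by linarith
    exact_mod_cast this
  have ht1 : ⌊4 * n / x⌋₊ ≤ Fintype.card U := by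
    rw [hcard]
    apply Nat.floor_le_of_le
    rw [div_le_iff₀ hx0]
    nlinarith
  have ht2 : ⌊n / (2 * x)⌋₊ ≤ Fintype.card U := by
    rw [hcard]
    apply Nat.floor_le_of_le
    rw [div_le_iff₀ (by positivity)]
    nlinarith
  obtain ⟨T₁, hT₁, htop₁⟩ := exists_top w σ _ ht1
  obtain ⟨T₂, hT₂, htop₂⟩ := exists_top w σ _ ht2
  have hc₁ : 4 * n / x - 1 ≤ (T₁.card : ℝ) := by
    rw [hT₁]; exact (Nat.sub_one_lt_floor _).le
  have hc₁' : (T₁.card : ℝ) ≤ 4 * n / x := by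
    rw [hT₁]; exact Nat.floor_le (by positivity)
  have hc₂ : (T₂.card : ℝ) ≤ n / (2 * x) := by
    rw [hT₂]; exact Nat.floor_le (by positivity)
  have hc₁n : (T₁.card : ℝ) ≤ n := by
    rw [hT₁]; exact_mod_cast ht1.trans_eq hcard
  -- Exponential moments to base 1/2 for too few hits of `T₁` (at most 179) and to base 2 for too
  -- many hits of `T₂` (at least 180).
  let f₁ : Item U → ℝ≥0∞ := fun x => if x.item ∈ T₁ then ENNReal.ofReal 2⁻¹ else 1
  let f₂ : Item U → ℝ≥0∞ := fun x => if x.item ∈ T₂ then ENNReal.ofReal 2 else 1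
  have hpow : ∀ r : ℝ, 0 ≤ r → ∀ k, ENNReal.ofReal r ^ k = ENNReal.ofReal (r ^ k) :=
    fun r hr k => (ENNReal.ofReal_pow hr k).symm
  calc _ ≤ expect (propDist w hW) (PMF.uniformOfFintype U) (rankedItem w σ)
        (Alg.unifSample.replicate m) (fun o c =>
          failInd (fun l c => l.length = m ∧ (∀ x ∈ l, x = rankedItem w σ x.item) ∧ c ≤ m) o c +
          (ENNReal.ofReal (2 ^ 179) * (o.elim 0 fun l => (l.map f₁).prod) +
          ENNReal.ofReal ((2 ^ 180)⁻¹) * (o.elim 0 fun l => (l.map f₂).prod))) := by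
        refine expect_mono _ _ _ _ fun o c => ?_
        cases o with
        | none => exact le_self_add
        | some l =>
          by_cases h : l.length = m ∧ (∀ x ∈ l, x = rankedItem w σ x.item) ∧ c ≤ m
          swap
          · rw [failInd_some_of_not (S := fun (l : List (Item U)) c => l.length = m ∧
              (∀ x ∈ l, x = rankedItem w σ x.item) ∧ c ≤ m) h]
            exact (failInd_le_one _ _ _).trans le_self_add
          obtain ⟨hlen, hl, hcm⟩ := h
          simp only [Option.elim, f₁, f₂]
          rw [prod_ite_eq_pow_countP l (fun x => x.item ∈ T₁),
            prod_ite_eq_pow_countP l (fun x => x.item ∈ T₂), hpow _ (by norm_num),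
            hpow _ (by norm_num), ← ENNReal.ofReal_mul (by positivity),
            ← ENNReal.ofReal_mul (by positivity)]
          by_cases h1 : 180 ≤ l.countP fun x => decide (x.item ∈ T₁)
          · by_cases h2 : 180 ≤ l.countP fun x => decide (x.item ∈ T₂)
            · refine (failInd_le_one _ _ _).trans (le_add_left (le_add_left ?_))
              rw [ENNReal.one_le_ofReal, inv_mul_eq_div, one_le_div (by positivity)]
              exact pow_le_pow_right₀ (by norm_num) h2
            · refine (failInd_some_of (S := fun (l : List (Item U)) c =>
                (n / (2 * x) ≤ ((heavy w σ (kthLargest 180 (l.map Item.key))).card : ℝ) ∧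
                ((heavy w σ (kthLargest 180 (l.map Item.key))).card : ℝ) ≤ 4 * n / x) ∧ c ≤ m)
                ⟨⟨?_, ?_⟩, hcm⟩).trans_le zero_le
              · by_contra hlt
                refine h2 (le_countP_of_card_heavy_le w σ htop₂ l hl (by norm_num)
                  (by rw [hlen]; exact hm180) ?_)
                rw [hT₂]
                exact Nat.le_floor (not_le.1 hlt).le
              · refine le_trans ?_ hc₁'
                exact_mod_cast Finset.card_le_card
                  (heavy_subset_of_le_countP w σ htop₁ l hl (by norm_num) h1)
          · refine (failInd_le_one _ _ _).trans (le_add_left (le_add_right ?_))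
            rw [ENNReal.one_le_ofReal, inv_pow, ← div_eq_mul_inv, one_le_div (by positivity)]
            exact pow_le_pow_right₀ (by norm_num) (by omega)
    _ = ENNReal.ofReal (2 ^ 179 * (1 + T₁.card / n * (2⁻¹ - 1)) ^ m) +
        ENNReal.ofReal ((2 ^ 180)⁻¹ * (1 + T₂.card / n * (2 - 1)) ^ m) := by
        rw [expect_add, expect_add, expect_mul_left, expect_mul_left, expect_replicate_prod,
          expect_replicate_prod, expect_unifSample_ite w σ hW T₁ (by norm_num),
          expect_unifSample_ite w σ hW T₂ (by norm_num)]
        have h0 := failProb_replicate_unifSample w σ hW m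
        unfold failProb at h0
        rw [h0, zero_add, hpow, hpow, ← ENNReal.ofReal_mul (by positivity),
          ← ENNReal.ofReal_mul (by positivity)]
        · positivity
        · have : (T₁.card : ℝ) / n ≤ 1 := by rwa [div_le_one hn']
          linarith
    _ ≤ ENNReal.ofReal (1 / 1000) + ENNReal.ofReal (1 / 1000) := by
        have he1 : (2 : ℝ) ≤ Real.exp 1 := by
          have := Real.add_one_le_exp (1 : ℝ); linarith
        have he2 : Real.exp 1 ≤ 3 := Real.exp_one_lt_three.le
        gcongr
        · have h1 : 1 + (T₁.card : ℝ) / n * (2⁻¹ - 1) ≤ Real.exp (-(T₁.card / n / 2)) := by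
            have := Real.add_one_le_exp (-((T₁.card : ℝ) / n / 2))
            linarith
          have h0 : 0 ≤ 1 + (T₁.card : ℝ) / n * (2⁻¹ - 1) := by
            have : (T₁.card : ℝ) / n ≤ 1 := by rwa [div_le_one hn']
            linarith
          -- Half of 480 - 120·x/n ≥ 472.5; the loss comes from rounding 4n / x down.
          have h2 : 236 ≤ (m : ℝ) * (T₁.card / n / 2) := by
            have h3 : 4 / x - 1 / n ≤ (T₁.card : ℝ) / n := by
              rw [le_div_iff₀ hn']
              calc (4 / x - 1 / n) * n = 4 * n / x - 1 := by field_simp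
                _ ≤ _ := hc₁
            have h4 : x / n ≤ 1 / 16 := by rw [div_le_div_iff₀ hn' (by norm_num)]; linarith
            have h5 : 120 * x * (4 / x - 1 / n) = 480 - 120 * (x / n) := by field_simp; ring
            have h6 : 120 * x * (4 / x - 1 / n) ≤ m * (T₁.card / n) :=
              (mul_le_mul_of_nonneg_left h3 (by positivity)).trans
                (mul_le_mul_of_nonneg_right hm1 (by positivity))
            linarith
          calc (2 : ℝ) ^ 179 * (1 + (T₁.card : ℝ) / n * (2⁻¹ - 1)) ^ m
              ≤ 2 ^ 179 * Real.exp (-(T₁.card / n / 2)) ^ m := by gcongr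
            _ = 2 ^ 179 * Real.exp (-(m * (T₁.card / n / 2))) := by
                rw [← Real.exp_nat_mul]; ring_nf
            _ ≤ 2 ^ 179 * Real.exp (-(236 : ℕ)) := by
                gcongr; push_cast; exact h2
            _ = 2 ^ 179 * (Real.exp 1 ^ 236)⁻¹ := by
                rw [Real.exp_neg, ← Real.exp_nat_mul, mul_one]
            _ ≤ 2 ^ 179 * (2 ^ 236)⁻¹ := by gcongr
            _ ≤ 1 / 1000 := by norm_num
        · have h1 : 1 + (T₂.card : ℝ) / n * (2 - 1) ≤ Real.exp (T₂.card / n) := by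
            have := Real.add_one_le_exp ((T₂.card : ℝ) / n)
            linarith
          have h2 : (m : ℝ) * (T₂.card / n) ≤ 61 := by
            have h3 : (T₂.card : ℝ) / n ≤ 1 / (2 * x) := by
              rw [div_le_iff₀ hn']
              calc (T₂.card : ℝ) ≤ n / (2 * x) := hc₂
                _ = _ := by ring
            have h4 : (m : ℝ) * (T₂.card / n) ≤ (120 * x + 1) * (1 / (2 * x)) := by gcongr
            have h5 : (120 * x + 1) * (1 / (2 * x)) = 60 + 1 / (2 * x) := by field_simp; ring
            have h6 : 1 / (2 * x) ≤ 1 := by rw [div_le_one (by positivity)]; linarith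
            linarith
          calc ((2 : ℝ) ^ 180)⁻¹ * (1 + (T₂.card : ℝ) / n * (2 - 1)) ^ m
              ≤ (2 ^ 180)⁻¹ * Real.exp (T₂.card / n) ^ m := by gcongr
            _ = (2 ^ 180)⁻¹ * Real.exp (m * (T₂.card / n)) := by rw [← Real.exp_nat_mul]
            _ ≤ (2 ^ 180)⁻¹ * Real.exp ((61 : ℕ) * 1) := by
                refine mul_le_mul_of_nonneg_left (Real.exp_le_exp.2 ?_) (by positivity)
                push_cast; linarith
            _ = (2 ^ 180)⁻¹ * Real.exp 1 ^ 61 := by rw [← Real.exp_nat_mul]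
            _ ≤ (2 ^ 180)⁻¹ * 3 ^ 61 := by gcongr
            _ ≤ 1 / 1000 := by norm_num
    _ ≤ ENNReal.ofReal (1 / 100) := by
        rw [← ENNReal.ofReal_add (by norm_num) (by norm_num)]
        exact ENNReal.ofReal_le_ofReal (by norm_num)

end Threshold

/-! ### `HybridEstimator` -/

section Hybrid

variable {U : Type*} [Fintype U] [DecidableEq U] {n : ℕ} (w : U → ℝ≥0)
  (hW : ∑ a, w a ≠ 0) (σ : U ≃ Fin n) (θ : Key)

omit [DecidableEq U] in
theorem heavy_light_sums :
    (heavy w σ θ).card * (θ.weight : ℝ) ≤ ∑ a ∈ heavy w σ θ, (w a : ℝ) ∧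
      ∑ a, (w a : ℝ) - ∑ a ∈ heavy w σ θ, (w a : ℝ) ≤
        (n - (heavy w σ θ).card) * (θ.weight : ℝ) := by
  have hcard : Fintype.card U = n := by simpa using Fintype.card_congr σ
  constructor
  · rw [← nsmul_eq_mul]
    refine Finset.card_nsmul_le_sum _ _ _ fun a ha => ?_
    exact_mod_cast Prod.Lex.monotone_fst _ _ (mem_heavy.1 ha)
  · have hsplit := Finset.sum_filter_add_sum_filter_not Finset.univ
      (fun a => θ ≤ (rankedItem w σ a).key) fun a => (w a : ℝ)
    have hlight : ∑ a with ¬θ ≤ (rankedItem w σ a).key, (w a : ℝ) ≤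
        (Finset.univ.filter fun a => ¬θ ≤ (rankedItem w σ a).key).card * (θ.weight : ℝ) := by
      rw [← nsmul_eq_mul]
      refine Finset.sum_le_card_nsmul _ _ _ fun a ha => ?_
      exact_mod_cast Prod.Lex.monotone_fst _ _ (not_le.1 (Finset.mem_filter.1 ha).2).le
    have hc := Finset.card_filter_add_card_filter_not (s := (Finset.univ : Finset U))
      (fun a => θ ≤ (rankedItem w σ a).key)
    rw [Finset.card_univ, hcard] at hc
    have hc' : ((heavy w σ θ).card : ℝ) +
        (Finset.univ.filter fun a => ¬θ ≤ (rankedItem w σ a).key).card = n := by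
      exact_mod_cast hc
    rw [← hc', add_sub_cancel_left]
    have : ∑ a ∈ heavy w σ θ, (w a : ℝ) = ∑ a with θ ≤ (rankedItem w σ a).key, (w a : ℝ) := rfl
    linarith

-- Heavy items weigh at least θ and light ones at most θ, so the average heavy weight is at least
-- the overall average. Thus the cost bound for uniform samples also serves for proportional ones.
omit [DecidableEq U] in
include hW in
theorem card_div_le_heavyMass : ((heavy w σ θ).card / n : ℝ) ≤ heavyMass w σ θ := by
  obtain ⟨h1, h2⟩ := heavy_light_sums w σ θ
  have hcard : Fintype.card U = n := by simpa using Fintype.card_congr σ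
  have hWpos := total_pos w hW
  have hcn : ((heavy w σ θ).card : ℝ) ≤ n := by
    exact_mod_cast (Finset.card_le_univ _).trans_eq hcard
  unfold heavyMass
  set V := ∑ a ∈ heavy w σ θ, (w a : ℝ)
  set W := ∑ a, (w a : ℝ)
  rcases n.eq_zero_or_pos with hn | hn
  · simp only [hn, Nat.cast_zero, div_zero]
    positivity
  have hn' : (0 : ℝ) < n := by exact_mod_cast hn
  rw [div_le_div_iff₀ hn' hWpos]
  have h3 := mul_le_mul_of_nonneg_left h2 (Nat.cast_nonneg (α := ℝ) (heavy w σ θ).card)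
  have h4 := mul_le_mul_of_nonneg_left h1 (sub_nonneg.2 hcn)
  nlinarith

omit [DecidableEq U] in
include hW in
theorem light_le : (1 - heavyMass w σ θ) * ∑ a, (w a : ℝ) ≤ n * θ.weight := by
  obtain ⟨-, h2⟩ := heavy_light_sums w σ θ
  have hWpos := total_pos w hW
  rw [heavyMass, sub_mul, one_mul, div_mul_cancel₀ _ hWpos.ne']
  refine h2.trans ?_
  gcongr
  simp

variable [Nonempty U] {ε x y : ℝ}

/-- A run takes at most 22y heavy samples, at an expected cost of at most 2 / p each. The bound 10⁶y
is so generous that Markov's inequality leaves failure probability 1/5000 per run, affordable for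
161 runs. -/
theorem failProb_prop_branch_le (hε : 0 < ε) (hε1 : ε < 1) (hy : 4 ≤ y) {n' : ℝ} (hn' : 0 < n')
    (hm : √(24 * n') / (ε / 3) ≤ 21 * y) (hH : ((heavy w σ θ).card : ℝ) ≤ 2 * n')
    {fuel : ℕ} (hfuel : ⌈10 ^ 6 * y⌉₊ ≤ fuel) {p' : ℝ≥0} (hp' : 1 / 2 ≤ p')
    (hp1 : heavyMass w σ θ / (1 + ε / 6) ≤ p') (hp2 : (p' : ℝ) ≤ heavyMass w σ θ / (1 - ε / 6)) :
    failProb (propDist w hW) (PMF.uniformOfFintype U) (rankedItem w σ)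
      ((amplify (19 / 20) (propEstimator
        (repeatUntil (fun a : Item U => θ ≤ a.key) Alg.propSample fuel) n' (ε / 3))).bind
          fun Wθ => .ret (Wθ / (p' : ℝ≥0∞)))
      (fun x c => IsApprox ε (∑ a, w a) x ∧ c ≤ 161 * ⌈10 ^ 6 * y⌉₊) ≤
      ENNReal.ofReal (1 / 20) := by
  have hWpos := total_pos w hW
  have hy0 : 0 < y := by linarith
  have e6 : 0 < 1 - ε / 6 := by linarith
  have e3 : 0 < 1 - ε / 3 := by linarith
  have e1 : 0 < 1 - ε := by linarith
  have hp'r : (1 / 2 : ℝ) ≤ p' := by exact_mod_cast hp'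
  have hp'0 : (0 : ℝ) < p' := by linarith
  rw [le_div_iff₀ e6] at hp2
  rw [div_le_iff₀ (by positivity)] at hp1
  -- (1/2) · (1 - 1/6) = 5/12: the true mass may be slightly below the tested value.
  have hp : 5 / 12 ≤ heavyMass w σ θ := by nlinarith
  have hp0 : 0 < heavyMass w σ θ := by linarith
  set B := ⌈10 ^ 6 * y⌉₊
  have hB : 10 ^ 6 * y ≤ (B : ℝ) := Nat.le_ceil _
  have hB0 : 0 < B := Nat.ceil_pos.2 (by positivity)
  have hBr : (0 : ℝ) < B := by exact_mod_cast hB0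
  have hceil : (⌈√(24 * n') / (ε / 3)⌉₊ : ℝ) + 1 ≤ 22 * y := by
    have := Nat.ceil_lt_add_one (a := √(24 * n') / (ε / 3)) (by positivity)
    linarith
  have hδ : 2 * ((⌈√(24 * n') / (ε / 3)⌉₊ : ℝ) + 1) / (heavyMass w σ θ * B) ≤ 1 / 5000 := by
    rw [div_le_div_iff₀ (by positivity) (by norm_num)]
    have : 5 / 12 * (10 ^ 6 * y) ≤ heavyMass w σ θ * B := by gcongr
    linarith
  have hcost := (failProb_propEstimator_cost_le w hW σ θ hp0 hB0 hfuel n' (ε / 3)).trans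
    (ENNReal.ofReal_le_ofReal hδ)
  have hgood := (failProb_propEstimator_le w hW σ θ hp0 hB0 hfuel hn' (by linarith : 0 < ε / 3)
    (by linarith) hH).trans (add_le_add_left (ENNReal.ofReal_le_ofReal hδ) _)
  have hthird : ENNReal.ofReal (1 / 5000) + ENNReal.ofReal (1 / 6) ≤ 1 / 3 := by
    rw [← ENNReal.ofReal_add (by norm_num) (by norm_num),
      show (1 / 3 : ℝ≥0∞) = ENNReal.ofReal (1 / 3) by
        rw [ENNReal.ofReal_div_of_pos (by norm_num)]; simp]
    exact ENNReal.ofReal_le_ofReal (by norm_num)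
  have hamp := failProb_amplify_le _ _ _ _ _ _ B (hgood.trans hthird) hcost (19 / 20)
  rw [ceil_amplify_nineteen_twentieths] at hamp
  rw [failProb_bind_ret]
  refine (failProb_mono _ _ _ _ ?_).trans (hamp.trans ?_)
  · rintro x c ⟨⟨hx1, hx2⟩, hc⟩
    refine ⟨?_, hc⟩
    have hV : ∑ a ∈ heavy w σ θ, (w a : ℝ) = heavyMass w σ θ * ∑ a, (w a : ℝ) := by
      rw [heavyMass, div_mul_cancel₀ _ hWpos.ne']
    rw [hV] at hx1 hx2
    unfold IsApprox
    rw [NNReal.coe_sum, ← ENNReal.ofReal_coe_nnreal (p := p')]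
    set W := ∑ a, (w a : ℝ)
    set p := heavyMass w σ θ
    constructor
    · refine le_trans ?_ (ENNReal.div_le_div_right hx1 _)
      rw [← ENNReal.ofReal_div_of_pos hp'0]
      apply ENNReal.ofReal_le_ofReal
      rw [div_div, le_div_iff₀ (by positivity)]
      have h1 : (1 - ε) * (1 + ε / 3) ≤ 1 - ε / 6 := by nlinarith
      calc (1 - ε) * W * ((1 + ε / 3) * p') = (1 - ε) * (1 + ε / 3) * (p' * W) := by ring
        _ ≤ (1 - ε / 6) * (p' * W) := by gcongr
        _ = p' * (1 - ε / 6) * W := by ring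
        _ ≤ p * W := by gcongr
    · refine le_trans (ENNReal.div_le_div_right hx2 _) ?_
      rw [← ENNReal.ofReal_div_of_pos hp'0]
      apply ENNReal.ofReal_le_ofReal
      rw [div_div, div_le_iff₀ (by positivity)]
      have h1 : 1 + ε / 6 ≤ (1 + ε) * (1 - ε / 3) := by nlinarith
      calc p * W ≤ p' * (1 + ε / 6) * W := by gcongr
        _ = (1 + ε / 6) * (p' * W) := by ring
        _ ≤ (1 + ε) * (1 - ε / 3) * (p' * W) := by gcongr
        _ = _ := by ring
  · refine (add_le_add_right (median_tail_le 80 (by norm_num)) _).trans ?_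
    rw [← ENNReal.ofReal_natCast, ← ENNReal.ofReal_mul (by positivity),
      ← ENNReal.ofReal_add (by positivity) (by norm_num)]
    exact ENNReal.ofReal_le_ofReal (by norm_num)

theorem failProb_harmonic_branch_le (hε : 0 < ε) (hε1 : ε < 1)
    (hH : 1 / (ε ^ 2 * ((heavy w σ θ).card / n)) ≤ 2 * y) (hH0 : 0 < (heavy w σ θ).card)
    {fuel : ℕ} (hfuel : ⌈22018 * y⌉₊ ≤ fuel) {p' : ℝ≥0} (hp' : p' < 1 / 2)
    (hp1 : heavyMass w σ θ / (1 + ε / 6) ≤ p') :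
    failProb (propDist w hW) (PMF.uniformOfFintype U) (rankedItem w σ)
      ((amplify (19 / 20) (harmonicEstimator fuel ε (3 * θ.weight) θ)).bind
        fun ρ => .ret ((n : ℝ≥0∞) * ρ))
      (fun x c => IsApprox ε (∑ a, w a) x ∧ c ≤ 161 * (81 * ⌈22018 * y⌉₊ + ⌈40908 * y⌉₊)) ≤
      ENNReal.ofReal (1 / 20) := by
  have hcard : Fintype.card U = n := by simpa using Fintype.card_congr σ
  have hn : 0 < n := Fintype.card_pos.trans_eq hcard
  have hn' : (0 : ℝ) < n := by exact_mod_cast hn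
  have hWpos := total_pos w hW
  have hp'r : (p' : ℝ) < 1 / 2 := by exact_mod_cast hp'
  rw [div_le_iff₀ (by positivity)] at hp1
  -- (1/2) · (1 + 1/6) = 7/12, so the light items carry at least 5/12 of the weight. Hence W ≤
  -- (12/5)nθ ≤ 3nθ, which justifies the advice 3θ and forces θ > 0.
  have hp : heavyMass w σ θ ≤ 7 / 12 := by nlinarith [p'.coe_nonneg]
  have hlight := light_le w hW σ θ
  have hlight' : 5 / 12 * ∑ a, (w a : ℝ) ≤ n * θ.weight :=
    le_trans (by gcongr; linarith) hlight
  have hθ : 0 < θ.weight := by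
    rw [← NNReal.coe_pos]
    by_contra h
    have h0 : (θ.weight : ℝ) = 0 := le_antisymm (not_lt.1 h) θ.weight.coe_nonneg
    rw [h0, mul_zero] at hlight'
    linarith
  have hθW : ∑ a, (w a : ℝ) ≤ 3 * n * θ.weight := by nlinarith
  have hB₁ : 109 * 101 / (ε ^ 2 * ((heavy w σ θ).card / n)) ≤ (⌈22018 * y⌉₊ : ℝ) := by
    refine le_trans ?_ (Nat.le_ceil _)
    rw [show 109 * 101 / (ε ^ 2 * ((heavy w σ θ).card / n : ℝ)) =
      11009 * (1 / (ε ^ 2 * ((heavy w σ θ).card / n))) by ring]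
    linarith
  have hB₂ : 20454 / (ε ^ 2 * ((heavy w σ θ).card / n)) ≤ (⌈40908 * y⌉₊ : ℝ) := by
    refine le_trans ?_ (Nat.le_ceil _)
    rw [show 20454 / (ε ^ 2 * ((heavy w σ θ).card / n : ℝ)) =
      20454 * (1 / (ε ^ 2 * ((heavy w σ θ).card / n))) by ring]
    linarith
  have hamp := failProb_amplify_le _ _ _ _ _ _ _
    (failProb_harmonicEstimator_le w hW σ θ hθ hH0 hθW hε hε1
      (hB₁.trans (by exact_mod_cast hfuel)))
    (failProb_harmonicEstimator_cost_le w hW σ θ hθ hH0 hε hε1 hB₁ hfuel hB₂) (19 / 20)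
  rw [ceil_amplify_nineteen_twentieths] at hamp
  rw [failProb_bind_ret]
  refine (failProb_mono _ _ _ _ ?_).trans (hamp.trans ?_)
  · rintro x c ⟨⟨hx1, hx2⟩, hc⟩
    refine ⟨?_, hc⟩
    unfold IsApprox
    rw [NNReal.coe_sum]
    have hmul : ∀ r : ℝ, (n : ℝ≥0∞) * ENNReal.ofReal (r / n) = ENNReal.ofReal r := by
      intro r
      rw [← ENNReal.ofReal_natCast, ← ENNReal.ofReal_mul hn'.le, mul_div_cancel₀ _ hn'.ne']
    rw [← hmul, ← hmul ((1 + ε) * _)]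
    exact ⟨mul_le_mul_right hx1 _, mul_le_mul_right hx2 _⟩
  · refine (add_le_add_right (median_tail_le 80 (by norm_num)) _).trans ?_
    rw [← ENNReal.ofReal_natCast, ← ENNReal.ofReal_mul (by positivity),
      ← ENNReal.ofReal_add (by positivity) (by norm_num)]
    exact ENNReal.ofReal_le_ofReal (by norm_num)

theorem failProb_hybridCore_le (hε : 0 < ε) (hε1 : ε < 1)
    (hx : (n : ℝ) ^ (1 / 3 : ℝ) * ε ^ (2 / 3 : ℝ) = x) (hx4 : 4 ≤ x)
    (hxn : x ^ 3 = n * ε ^ 2) (hy : y * ε ^ 2 = x)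
    (hh : (n : ℝ) ^ (2 / 3 : ℝ) / ε ^ (2 / 3 : ℝ) = (y * ε) ^ 2) {fuel : ℕ}
    (hfuel : 10 ^ 9 * y - 1 ≤ fuel) :
    failProb (propDist w hW) (PMF.uniformOfFintype U) (rankedItem w σ) (hybridCore fuel n ε)
      (fun x c => IsApprox ε (∑ a, w a) x ∧ c ≤ fuel) ≤ ENNReal.ofReal (1 / 3) := by
  have hcard : Fintype.card U = n := by simpa using Fintype.card_congr σ
  have hn : 0 < n := Fintype.card_pos.trans_eq hcard
  have hn' : (0 : ℝ) < n := by exact_mod_cast hn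
  have hx0 : 0 < x := by linarith
  have hε2 : ε ^ 2 ≤ 1 := pow_le_one₀ hε.le hε1.le
  have hxy : x ≤ y := by
    have : 0 < y := by
      by_contra h
      have : y * ε ^ 2 ≤ 0 := mul_nonpos_of_nonpos_of_nonneg (not_lt.1 h) (by positivity)
      linarith
    rw [← hy]
    nlinarith
  have hy4 : 4 ≤ y := hx4.trans hxy
  have hy0 : 0 < y := by linarith
  have hxn' : 16 * x ≤ n := by
    have h1 : x ^ 3 ≤ n := by rw [hxn]; nlinarith
    have h2 : 16 * x ≤ x ^ 3 := by nlinarith [mul_nonneg hx0.le (by nlinarith : 0 ≤ x ^ 2 - 16)]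
    linarith
  -- This identity balances the two cases: √(n / x) / ε, the cost of collisions, equals x / ε², the
  -- cost of the harmonic average.
  have hnx : (n : ℝ) / x = (y * ε) ^ 2 := by
    rw [div_eq_iff hx0.ne']
    have h1 : (n : ℝ) * ε ^ 2 = (y * ε) ^ 2 * x * ε ^ 2 := by
      rw [← hxn, mul_pow, ← hy]; ring
    exact mul_right_cancel₀ (by positivity) h1
  unfold hybridCore
  have hsum : ENNReal.ofReal (1 / 100) + (ENNReal.ofReal (1 / 30) + ENNReal.ofReal (1 / 20)) ≤
      ENNReal.ofReal (1 / 3) := by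
    rw [← ENNReal.ofReal_add (by norm_num) (by norm_num),
      ← ENNReal.ofReal_add (by norm_num) (by norm_num)]
    exact ENNReal.ofReal_le_ofReal (by norm_num)
  refine (failProb_bind_le _ _ _ _ _ _ _ (failProb_findThreshold_le w σ hW hx hx4 hxn')
    fun θ c₁ hθ => ?_).trans hsum
  obtain ⟨⟨hN1, hN2⟩, hc₁⟩ := hθ
  have hN0 : (0 : ℝ) < (heavy w σ θ).card := lt_of_lt_of_le (by positivity) hN1
  have hpu : 1 / (2 * x) ≤ ((heavy w σ θ).card / n : ℝ) := by
    rw [div_le_div_iff₀ (by positivity) hn', one_mul]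
    rwa [div_le_iff₀ (by positivity)] at hN1
  have hpm := hpu.trans (card_div_le_heavyMass w hW σ θ)
  have hinv : ∀ p : ℝ, 1 / (2 * x) ≤ p → 1 / (ε ^ 2 * p) ≤ 2 * y := by
    intro p hp
    have hp0 : 0 < p := lt_of_lt_of_le (by positivity) hp
    rw [div_le_iff₀ (by positivity)] at hp ⊢
    rw [← hy] at hp
    linarith
  have hp0 : 0 < heavyMass w σ θ := lt_of_lt_of_le (by positivity) hpm
  have hp1 := heavyMass_le_one w hW σ θ
  have hceil : ∀ r : ℝ, 0 ≤ r → (⌈r⌉₊ : ℝ) ≤ r + 1 := fun r hr => (Nat.ceil_lt_add_one hr).le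
  have hB : 109 * 11 / (ε ^ 2 * heavyMass w σ θ) ≤ (⌈2398 * y⌉₊ : ℝ) := by
    refine le_trans ?_ (Nat.le_ceil _)
    have := hinv _ hpm
    rw [show 109 * 11 / (ε ^ 2 * heavyMass w σ θ) =
      1199 * (1 / (ε ^ 2 * heavyMass w σ θ)) by ring]
    linarith
  have hBf : ⌈2398 * y⌉₊ ≤ fuel := by
    have : (⌈2398 * y⌉₊ : ℝ) ≤ fuel := (hceil _ (by positivity)).trans (by linarith)
    exact_mod_cast this
  have hexp := isExperiment_propSample w hW σ θ
  have hamp := failProb_amplify_le _ _ _ _ _ _ _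
    (failProb_bernoulliEstimator_le _ _ _ hexp hp0 hp1 hε hε1 (fuel := fuel)
      (le_trans (by gcongr; norm_num) (hB.trans (by exact_mod_cast hBf))))
    ((failProb_mono _ _ _ _ fun _ _ h => h.2).trans
      (failProb_bernoulliEstimator_cost_le _ _ _ hexp hp0 hp1 hε hε1
        (K := 11) (by norm_num) hB hBf)) (19 / 20)
  rw [ceil_amplify_nineteen_twentieths] at hamp
  have htail : ((2 * 80 + 1 : ℕ) : ℝ≥0∞) * ENNReal.ofReal (1 / (108 * (11 - 1) ^ 2)) +
      2⁻¹ ^ (80 + 1) * (4 / 3) ^ (2 * 80 + 1) ≤ ENNReal.ofReal (1 / 30) := by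
    refine (add_le_add_right (median_tail_le 80 (by norm_num)) _).trans ?_
    rw [← ENNReal.ofReal_natCast, ← ENNReal.ofReal_mul (by positivity),
      ← ENNReal.ofReal_add (by positivity) (by norm_num)]
    exact ENNReal.ofReal_le_ofReal (by norm_num)
  refine failProb_bind_le _ _ _ _ _ _ _ (hamp.trans htail) fun p' c₂ hp' => ?_
  obtain ⟨⟨hp'1, hp'2⟩, hc₂⟩ := hp'
  rw [Real.toNNReal_le_iff_le_coe] at hp'1
  have e6 : 0 < 1 - ε / 6 := by linarith
  rw [← NNReal.coe_le_coe, Real.coe_toNNReal _ (by positivity)] at hp'2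
  have hc₁' : (c₁ : ℝ) ≤ 120 * x + 1 :=
    le_trans (by exact_mod_cast hc₁) (hceil _ (by positivity))
  have hc₂' : (c₂ : ℝ) ≤ 161 * (2398 * y + 1) :=
    le_trans (by exact_mod_cast hc₂) (mul_le_mul_of_nonneg_left (hceil _ (by positivity))
      (by norm_num : (0 : ℝ) ≤ 161))
  split_ifs with hhalf
  · have hn'' : (0 : ℝ) < 2 * ((n : ℝ) ^ (2 / 3 : ℝ) / ε ^ (2 / 3 : ℝ)) := by rw [hh]; positivity
    refine (failProb_mono _ _ _ _ ?_).trans (failProb_prop_branch_le w hW σ θ hε hε1 hy4 hn'' ?_ ?_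
      ?_ hhalf hp'1 hp'2)
    · rintro z c₃ ⟨hz, hc₃⟩
      refine ⟨hz, ?_⟩
      have hc₃' : (c₃ : ℝ) ≤ 161 * (10 ^ 6 * y + 1) :=
        le_trans (by exact_mod_cast hc₃) (mul_le_mul_of_nonneg_left (hceil _ (by positivity))
          (by norm_num : (0 : ℝ) ≤ 161))
      have : ((c₁ + (c₂ + c₃) : ℕ) : ℝ) ≤ fuel := by
        push_cast
        linarith
      exact_mod_cast this
    -- Since 48 ≤ 7², the square root is at most 7yε, and division by ε/3 gives 21y.
    · rw [hh, show 24 * (2 * (y * ε) ^ 2) = 48 * (y * ε) ^ 2 by ring,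
        div_le_iff₀ (by positivity)]
      calc √(48 * (y * ε) ^ 2) ≤ √((7 * (y * ε)) ^ 2) := by
            apply Real.sqrt_le_sqrt
            nlinarith [sq_nonneg (y * ε)]
        _ = 7 * (y * ε) := Real.sqrt_sq (by positivity)
        _ = 21 * y * (ε / 3) := by ring
    · rw [hh, ← hnx]
      refine hN2.trans_eq ?_
      ring
    · have : (⌈10 ^ 6 * y⌉₊ : ℝ) ≤ fuel := (hceil _ (by positivity)).trans (by linarith)
      exact_mod_cast this
  · refine (failProb_mono _ _ _ _ ?_).trans (failProb_harmonic_branch_le w hW σ θ hε hε1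
      (hinv _ hpu) (by exact_mod_cast hN0) ?_ (not_le.1 hhalf) hp'1)
    · rintro z c₃ ⟨hz, hc₃⟩
      refine ⟨hz, ?_⟩
      have hc₃' : (c₃ : ℝ) ≤ 161 * (81 * (22018 * y + 1) + (40908 * y + 1)) := by
        have h1 := hceil (22018 * y) (by positivity)
        have h2 := hceil (40908 * y) (by positivity)
        have h3 : (c₃ : ℝ) ≤ 161 * (81 * (⌈22018 * y⌉₊ : ℝ) + ⌈40908 * y⌉₊) := by
          exact_mod_cast hc₃
        linarith
      have : ((c₁ + (c₂ + c₃) : ℕ) : ℝ) ≤ fuel := by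
        push_cast
        linarith
      exact_mod_cast this
    · have : (⌈22018 * y⌉₊ : ℝ) ≤ fuel := (hceil _ (by positivity)).trans (by linarith)
      exact_mod_cast this

end Hybrid

end HybridSampling

theorem mainTheorem3 :
    ∃ C₀ : ℝ, 0 < C₀ ∧ ∀ C : ℝ, C₀ ≤ C →
      ∀ (U : Type*) [Fintype U] [DecidableEq U] [Nonempty U] (w : U → ℝ≥0)
        (hW : ∑ a, w a ≠ 0) (n : ℕ) (ε : ℝ), n = Fintype.card U →
        8 / √(n : ℝ) ≤ ε → ε < 1 →
          (∀ y ∈ (HybridSampling.run w hW (HybridSampling.hybridEstimator U C n ε)).support,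
            (y.2 : ℝ) ≤ C * ((n : ℝ) ^ (1 / 3 : ℝ) / ε ^ (4 / 3 : ℝ))) ∧
          (2 / 3 : ℝ≥0∞) ≤
            (HybridSampling.run w hW (HybridSampling.hybridEstimator U C n ε)).toOuterMeasure
              {y | ∃ x : ℝ≥0∞, y.1 = some x ∧ HybridSampling.IsApprox ε (∑ a, w a) x} := by
  open HybridSampling in
  -- The costliest path uses about 3 · 10⁸ · y samples, 161 · (81 · 22018 + 40908) · y of them in
  -- the harmonic case; 10⁹ also absorbs the ceilings and the floor in the budget.
  refine ⟨10 ^ 9, by norm_num, fun C hC U _ _ _ w hW n ε hn hε hε1 => ?_⟩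
  have hn0 : 0 < n := hn ▸ Fintype.card_pos
  have hn' : (0 : ℝ) < n := by exact_mod_cast hn0
  have hε0 : 0 < ε := lt_of_lt_of_le (by positivity) hε
  set y : ℝ := (n : ℝ) ^ (1 / 3 : ℝ) / ε ^ (4 / 3 : ℝ) with hydef
  have hy0 : 0 < y := by positivity
  have hCy : 0 ≤ C * y := mul_nonneg (le_trans (by norm_num) hC) hy0.le
  constructor
  · intro z hz
    exact (Nat.le_floor_iff hCy).1 (run_withBudget_cost_le w hW _ _ z hz)
  unfold hybridEstimator
  simp only
  rw [run_withBudget_toOuterMeasure w hW _ _ (IsApprox ε (∑ a, w a))]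
  refine le_expect_attachRanks _ _ w hn _ _ _ fun σ => ?_
  have hxn : ((n : ℝ) ^ (1 / 3 : ℝ) * ε ^ (2 / 3 : ℝ)) ^ 3 = n * ε ^ 2 := by
    rw [mul_pow, ← Real.rpow_natCast, ← Real.rpow_natCast (ε ^ _), ← Real.rpow_mul hn'.le,
      ← Real.rpow_mul hε0.le]
    norm_num
  have hyx : y * ε ^ 2 = (n : ℝ) ^ (1 / 3 : ℝ) * ε ^ (2 / 3 : ℝ) := by
    rw [hydef, div_mul_eq_mul_div, mul_div_assoc, ← Real.rpow_natCast ε, ← Real.rpow_sub hε0]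
    norm_num
  have hh : (n : ℝ) ^ (2 / 3 : ℝ) / ε ^ (2 / 3 : ℝ) = (y * ε) ^ 2 := by
    have h1 : y * ε = (n : ℝ) ^ (1 / 3 : ℝ) / ε ^ (1 / 3 : ℝ) := by
      rw [hydef, div_mul_eq_mul_div, div_eq_div_iff (by positivity) (by positivity), mul_assoc]
      congr 1
      nth_rewrite 1 [← Real.rpow_one ε]
      rw [← Real.rpow_add hε0]
      norm_num
    rw [h1, div_pow, ← Real.rpow_natCast, ← Real.rpow_natCast (ε ^ _), ← Real.rpow_mul hn'.le,
      ← Real.rpow_mul hε0.le]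
    norm_num
  -- The cube of this quantity is nε², which is at least 8² = 4³ by the lower bound on ε.
  have hx4 : 4 ≤ (n : ℝ) ^ (1 / 3 : ℝ) * ε ^ (2 / 3 : ℝ) := by
    refine le_of_pow_le_pow_left₀ (n := 3) (by norm_num) (by positivity) ?_
    rw [hxn]
    rw [div_le_iff₀ (by positivity)] at hε
    calc (4 : ℝ) ^ 3 = 8 ^ 2 := by norm_num
      _ ≤ (ε * √n) ^ 2 := by gcongr
      _ = n * ε ^ 2 := by rw [mul_pow, Real.sq_sqrt hn'.le]; ring
  have hfail := failProb_hybridCore_le w hW σ (ε := ε) (y := y) hε0 hε1 rfl hx4 hxn hyx hh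
    (fuel := ⌊C * y⌋₊) (by
      have h1 := (Nat.lt_floor_add_one (C * y)).le
      have h2 : 10 ^ 9 * y ≤ C * y := by gcongr
      linarith)
  have hadd := expect_success_add_failProb (propDist w hW) (PMF.uniformOfFintype U)
    (rankedItem w σ) (hybridCore ⌊C * y⌋₊ n ε) ⌊C * y⌋₊ (IsApprox ε (∑ a, w a))
  have hsub : (2 / 3 : ℝ≥0∞) + ENNReal.ofReal (1 / 3) = 1 := by
    rw [show (2 / 3 : ℝ≥0∞) = ENNReal.ofReal (2 / 3) by
      rw [ENNReal.ofReal_div_of_pos (by norm_num)]; simp,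
      ← ENNReal.ofReal_add (by norm_num) (by norm_num)]
    norm_num
  refine (ENNReal.add_le_add_iff_right (a := ENNReal.ofReal (1 / 3)) (by simp)).1 ?_
  exact (hsub.trans hadd.symm).trans_le (add_le_add_right hfail _)
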